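/- The UR5 robot has six revolute joints. Its Denavit–Hartenberg parameters are the distances $(a_1,\dots,a_6)=(0,-0.425,-0.39225,0,0,0)$, the offsets $(d_1,\dots,d_6)=(0,0,0,0.10915,0.09465,0)$ and the twists $(\alpha_1,\dots,\alpha_6)=(\frac{\pi}{2},0,0,\frac{\pi}{2},-\frac{\pi}{2},0)$. Its kinematic map is $$F:\mathrm{SO}(2)^6\to \mathrm{SE}(3),\qquad F(\theta)=\prod_{i=1}^6 R_z(\theta_i)T_z(d_i)T_x(a_i)R_x(\alpha_i).$$ A configuration is a kinematic singularity if the Jacobian of $F$ is rank deficient there. With $a_2=-0.425$, $a_3=-0.39225$, $d_5=0.09465$, let $$\begin{aligned}\tilde B={}&a_2v_2^2v_3^2v_4^2-a_3v_2^2v_3^2v_4^2-2d_5v_2^2v_3^2v_4-2d_5v_2^2v_3v_4^2-2d_5v_2v_3^2v_4^2+a_2v_2^2v_3^2+a_2v_2^2v_4^2-a_2v_3^2v_4^2\\&-a_3v_2^2v_3^2+a_3v_2^2v_4^2+4a_3v_2v_3v_4^2+a_3v_3^2v_4^2+2d_5v_2^2v_3+2d_5v_2^2v_4+2d_5v_2v_3^2+8d_5v_2v_3v_4+2d_5v_2v_4^2\\&+2d_5v_3^2v_4+2d_5v_3v_4^2+a_2v_2^2-a_2v_3^2-a_2v_4^2+a_3v_2^2+4a_3v_2v_3+a_3v_3^2-a_3v_4^2-2d_5v_2-2d_5v_3-2d_5v_4-a_2-a_3,\end{aligned}$$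 and $\tilde A=\tilde B v_3v_5$. Here $v_i=\tan\frac{\theta_i}{2}$, where $v_2$ ranges over $\mathbb P^1(\mathbb R)$, identified with the circle of angles $\theta_2$, and $v_3,v_4,v_5$ range over $\mathbb R$. As $\tilde B$ is quadratic in $v_2$, it is regarded as a quadratic form on $\mathbb P^1$, so it has a well-defined sign at each point. Let $N=\{\tilde A\neq0\}\subset\mathbb P^1\times\mathbb A^3$. Then the following hold. 1. Every configuration with $\theta_3=\pi$ or $\theta_5=\pi$ is singular. If $\theta_3,\theta_4,\theta_5\ne\pi$, the configuration is singular if and only if $\tilde A=0$, whatever $\theta_1$ and $\theta_6$ are. 2. The set of non-singular configurations in $\mathrm{SO}(2)^6$ has exactly $8$ connected components, and so does $N$. Two non-singular configurations with $\theta_3,\theta_4,\theta_5\neq\pi$ lie in the same component if and only if the corresponding points of $N$ lie in the same component of $N$. Two points of $N$ lie in the same component of $N$ if and only if they have the same sign of $\tilde B$, the same sign of $v_3$ and the same sign of $v_5$. 3. One has $$\operatorname{disc}(\tilde B,v_2)=\frac{(1+v_3^2)(1+v_4^2)}{5\cdot10^{7}}\,(c^2+d^2),$$ $$c=\frac{1577212v_3-3561263v_4-14850585}{\sqrt{2006237}},\qquad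 d=\frac{(2006237v_4+1239915)v_3+16090500v_4-7144712}{\sqrt{2006237}},$$ and $\operatorname{disc}(\tilde B,v_2)$ is a sum of two squares in $\mathbb R[v_3,v_4]$. Its real zero set consists of exactly two points $q_1,q_2$. Up to an error less than $10^{-8}$ in each coordinate, they are $q_1\approx(-9.140975564,-8.218388067)$ and $q_2\approx(9.140975563,-0.1216783622)$. All coefficients of $\tilde B$ with respect to $v_2$ vanish at $q_1$ and at $q_2$. 4. Let $Y=\mathbb A^2\setminus(\{q_1,q_2\}\cup\{v_3=0\})$. It has two components. Over $Y$, the projection of the zero set of $\tilde B$ in $\mathbb P^1\times\mathbb A^2$ to the $(v_3,v_4)$-plane is a two-sheeted covering. It consists of two disjoint sheets that are graphs of continuous functions on $Y$. The whole zero set of $\tilde B$ in $\mathbb P^1\times\mathbb A^2$ is connected. In each fiber over $Y$, the sets $\{\tilde B>0\}$ and $\{\tilde B<0\}$ are nonempty and connected. The complement of the zero set of $\tilde B$ in $\mathbb P^1\times Y$ has $4$ components. 5. Over each $q\in Y$ there are exactly two midpoints, that is, points of the circle at equal angle distance from the two zeros of $\tilde B$. One of them, $m_{+}(q)$, has $\tilde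 B>0$ and the other, $m_-(q)$, has $\tilde B<0$. Both $m_\pm$ are continuous on $Y$. Let $x,y$ be in the same component of $N$ and let $\varepsilon$ be the sign of $\tilde B$ at $x$. Then the projections $\bar x,\bar y$ of $x,y$ to the $(v_3,v_4)$-plane lie in $Y$, and a path in $N$ from $x$ to $y$ is composed as follows: - a path with constant $(v_3,v_4,v_5)$ from $x$ to the midpoint $m_\varepsilon(\bar x)$; - the path $t\mapsto(m_\varepsilon(\gamma(t)),\gamma(t),v_5(t))$, where $\gamma$ is any path in $Y$ from $\bar x$ to $\bar y$ and $v_5(t)$ runs linearly from $v_5(x)$ to $v_5(y)$; - a path with constant $(v_3,v_4,v_5)$ from $m_\varepsilon(\bar y)$ to $y$. For $\gamma$ one can take the straight segment if it contains neither $q_1$ nor $q_2$, and in every case two straight segments via a suitable third point. 6. From every non-singular configuration one can reach a non-singular configuration with $\theta_4\neq\pi$ along a path of non-singular configurations on which only $\theta_4$ varies. Any two configurations in the same component of the set of non-singular configurations are joined by a path in that set. -/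

import Mathlib

noncomputable section

namespace UR5

/-! ### Serial robots with six revolute joints, in Denavit-Hartenberg convention -/

/-- The fixed Denavit-Hartenberg parameters of a robot with six revolute joints
(metres and radians). -/
structure DHParameters where
  distance : Fin 6 → ℝ
  offset : Fin 6 → ℝ
  twist : Fin 6 → ℝ

/-- Rotation about the `z`-axis, as a homogeneous `4 × 4` matrix in `SE(3)`. -/
def rotZ (θ : Real.Angle) : Matrix (Fin 4) (Fin 4) ℝ :=
  !![θ.cos, -θ.sin, 0, 0;
     θ.sin, θ.cos, 0, 0;
     0, 0, 1, 0;
     0, 0, 0, 1]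

/-- Translation along the `z`-axis. -/
def transZ (d : ℝ) : Matrix (Fin 4) (Fin 4) ℝ :=
  !![1, 0, 0, 0;
     0, 1, 0, 0;
     0, 0, 1, d;
     0, 0, 0, 1]

/-- Translation along the `x`-axis. -/
def transX (a : ℝ) : Matrix (Fin 4) (Fin 4) ℝ :=
  !![1, 0, 0, a;
     0, 1, 0, 0;
     0, 0, 1, 0;
     0, 0, 0, 1]

/-- Rotation about the `x`-axis. -/
def rotX (α : ℝ) : Matrix (Fin 4) (Fin 4) ℝ :=
  !![1, 0, 0, 0;
     0, Real.cos α, -Real.sin α, 0;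
     0, Real.sin α, Real.cos α, 0;
     0, 0, 0, 1]

/-- The kinematic map `SO(2)⁶ → SE(3)`, with `SE(3)` embedded in the `4 × 4` matrices: the
product over the joints of `R_z(θ_i) T_z(d_i) T_x(a_i) R_x(α_i)`. -/
def kinematicMap (R : DHParameters) (θ : Fin 6 → Real.Angle) : Matrix (Fin 4) (Fin 4) ℝ :=
  (List.ofFn fun i =>
    rotZ (θ i) * transZ (R.offset i) * transX (R.distance i) * rotX (R.twist i)).prod

/-- The Jacobian matrix of the kinematic map at `θ`: the partial derivatives of the 16 matrix
entries with respect to the six joint angles. Its rank is the rank of the differential of the map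
into `SE(3)`, as `SE(3)` is an embedded submanifold of the matrices. -/
def jacobian (R : DHParameters) (θ : Fin 6 → Real.Angle) :
    Matrix (Fin 4 × Fin 4) (Fin 6) ℝ :=
  Matrix.of fun rc i =>
    deriv (fun t : ℝ =>
      kinematicMap R (Function.update θ i (θ i + (t : Real.Angle))) rc.1 rc.2) 0

/-- The kinematic singularities: the configurations where the Jacobian is rank deficient. -/
def singularSet (R : DHParameters) : Set (Fin 6 → Real.Angle) :=
  {θ | (jacobian R θ).rank < 6}

/-- The UR5 robot. -/
def ur5 : DHParameters where
  distance := ![0, -425 / 1000, -39225 / 100000, 0, 0, 0]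
  offset := ![0, 0, 0, 10915 / 100000, 9465 / 100000, 0]
  twist := ![Real.pi / 2, 0, 0, Real.pi / 2, -Real.pi / 2, 0]

/-! ### The polynomial `B` -/

/-- The large factor `B` of the Jacobian determinant of a UR robot. -/
def urB {S : Type*} [CommRing S] (a₂ a₃ d₅ v₂ v₃ v₄ : S) : S :=
  a₂ * v₂ ^ 2 * v₃ ^ 2 * v₄ ^ 2 - a₃ * v₂ ^ 2 * v₃ ^ 2 * v₄ ^ 2 - 2 * d₅ * v₂ ^ 2 * v₃ ^ 2 * v₄
    - 2 * d₅ * v₂ ^ 2 * v₃ * v₄ ^ 2 - 2 * d₅ * v₂ * v₃ ^ 2 * v₄ ^ 2 + a₂ * v₂ ^ 2 * v₃ ^ 2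
    + a₂ * v₂ ^ 2 * v₄ ^ 2 - a₂ * v₃ ^ 2 * v₄ ^ 2 - a₃ * v₂ ^ 2 * v₃ ^ 2 + a₃ * v₂ ^ 2 * v₄ ^ 2
    + 4 * a₃ * v₂ * v₃ * v₄ ^ 2 + a₃ * v₃ ^ 2 * v₄ ^ 2 + 2 * d₅ * v₂ ^ 2 * v₃
    + 2 * d₅ * v₂ ^ 2 * v₄ + 2 * d₅ * v₂ * v₃ ^ 2 + 8 * d₅ * v₂ * v₃ * v₄
    + 2 * d₅ * v₂ * v₄ ^ 2 + 2 * d₅ * v₃ ^ 2 * v₄ + 2 * d₅ * v₃ * v₄ ^ 2 + a₂ * v₂ ^ 2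
    - a₂ * v₃ ^ 2 - a₂ * v₄ ^ 2 + a₃ * v₂ ^ 2 + 4 * a₃ * v₂ * v₃ + a₃ * v₃ ^ 2 - a₃ * v₄ ^ 2
    - 2 * d₅ * v₂ - 2 * d₅ * v₃ - 2 * d₅ * v₄ - a₂ - a₃

/-- The polynomial `B̃`, the specialization of `B` to UR5, as a polynomial in `v₂` over
`ℝ[v₃, v₄]`, where `v₃`, `v₄` are the variables number `0`, `1`. -/
def Btilde : Polynomial (MvPolynomial (Fin 2) ℝ) :=
  urB (Polynomial.C (MvPolynomial.C (-425 / 1000)))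
    (Polynomial.C (MvPolynomial.C (-39225 / 100000)))
    (Polynomial.C (MvPolynomial.C (9465 / 100000)))
    Polynomial.X (Polynomial.C (MvPolynomial.X 0)) (Polynomial.C (MvPolynomial.X 1))

/-- The coefficient of `v₂ ^ k` in `B̃` at the point `q = (v₃, v₄)`. -/
def Bcoeff (k : ℕ) (q : ℝ × ℝ) : ℝ :=
  MvPolynomial.eval ![q.1, q.2] (Btilde.coeff k)

/-- `B̃` on `ℙ¹(ℝ) × ℝ²`. The variable `v₂ = tan (θ₂ / 2)` ranges over `ℙ¹(ℝ)`, that is,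
the angle `θ₂` over the circle (`v₂ = ∞` is `θ₂ = π`). This is the homogeneous
quadratic form `b₂ s² + b₁ s c + b₀ c²` of `B̃` at `(s : c) = (sin (θ₂ / 2) : cos (θ₂ / 2))`,
written with the double angle. -/
def BP (θ₂ : Real.Angle) (q : ℝ × ℝ) : ℝ :=
  Bcoeff 2 q * ((1 - θ₂.cos) / 2) + Bcoeff 1 q * (θ₂.sin / 2) + Bcoeff 0 q * ((1 + θ₂.cos) / 2)

theorem Btilde_natDegree_le : Btilde.natDegree ≤ 2 := by
  unfold Btilde urB
  compute_degree

/-- At a finite `v₂`, the value `BP` is the value of the polynomial up to a positive factor. -/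
theorem BP_two_arctan (v₂ v₃ v₄ : ℝ) :
    BP ((2 * Real.arctan v₂ : ℝ) : Real.Angle) (v₃, v₄) =
      urB (-425 / 1000) (-39225 / 100000) (9465 / 100000) v₂ v₃ v₄ / (1 + v₂ ^ 2) := by
  have h : urB (-425 / 1000) (-39225 / 100000) (9465 / 100000) v₂ v₃ v₄ =
      Bcoeff 2 (v₃, v₄) * v₂ ^ 2 + Bcoeff 1 (v₃, v₄) * v₂ + Bcoeff 0 (v₃, v₄) := by
    have h1 : urB (-425 / 1000) (-39225 / 100000) (9465 / 100000) v₂ v₃ v₄ =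
        (Btilde.map (MvPolynomial.eval ![v₃, v₄])).eval v₂ := by
      simp [Btilde, urB]
      ring
    rw [h1, Polynomial.eval_eq_sum_range' (n := 3)
      (lt_of_le_of_lt (Polynomial.natDegree_map_le.trans Btilde_natDegree_le) (by norm_num))]
    simp [Finset.sum_range_succ, Bcoeff]
    ring
  have hp : 0 < 1 + v₂ ^ 2 := by positivity
  have hs : Real.sin (2 * Real.arctan v₂) = 2 * v₂ / (1 + v₂ ^ 2) := by
    rw [Real.sin_two_mul, Real.sin_arctan, Real.cos_arctan]
    have := Real.sq_sqrt hp.le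
    have h0 : Real.sqrt (1 + v₂ ^ 2) ≠ 0 := (Real.sqrt_pos.2 hp).ne'
    field_simp
    rw [this]
  have hc : Real.cos (2 * Real.arctan v₂) = (1 - v₂ ^ 2) / (1 + v₂ ^ 2) := by
    rw [Real.cos_two_mul, Real.cos_sq_arctan]
    field_simp
    ring
  rw [h, BP, Real.Angle.cos_coe, Real.Angle.sin_coe, hs, hc]
  field_simp
  ring

/-- The real polynomial `c` in `v₃`, `v₄`. -/
def cPoly : MvPolynomial (Fin 2) ℝ :=
  MvPolynomial.C (Real.sqrt 2006237)⁻¹ *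
    (MvPolynomial.C 1577212 * MvPolynomial.X 0 - MvPolynomial.C 3561263 * MvPolynomial.X 1
      - MvPolynomial.C 14850585)

/-- The real polynomial `d` in `v₃`, `v₄`. -/
def dPoly : MvPolynomial (Fin 2) ℝ :=
  MvPolynomial.C (Real.sqrt 2006237)⁻¹ *
    ((MvPolynomial.C 2006237 * MvPolynomial.X 1 + MvPolynomial.C 1239915) * MvPolynomial.X 0
      + MvPolynomial.C 16090500 * MvPolynomial.X 1 - MvPolynomial.C 7144712)

/-! ### The spaces over the `(v₃, v₄)`-plane -/

/-- The zero set of `B̃` in `ℙ¹ × 𝔸²`. -/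
def zeroSetB : Set (Real.Angle × (ℝ × ℝ)) := {x | BP x.1 x.2 = 0}

/-- The plane without `q₁`, `q₂` and the line `v₃ = 0`. -/
def baseY (q₁ q₂ : ℝ × ℝ) : Set (ℝ × ℝ) := ({q₁, q₂} ∪ {q | q.1 = 0})ᶜ

/-- The space `ℙ¹ × 𝔸³` of the parameters `v₂`, `v₃`, `v₄`, `v₅`. -/
abbrev ReducedConfig : Type := Real.Angle × (ℝ × ℝ) × ℝ

/-- The polynomial `Ã = B̃ v₃ v₅` on `ℙ¹ × 𝔸³`. -/
def AP (x : ReducedConfig) : ℝ := BP x.1 x.2.1 * x.2.1.1 * x.2.2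

/-- The complement of the zero set of `Ã`. -/
def nonsingularReduced : Set ReducedConfig := {x | AP x ≠ 0}

/-- The joint angles given by `θ₁`, `θ₆` and the parameters `v₂, …, v₅`, where
`v_i = tan (θ_i / 2)`. -/
def jointAngles (θ₁ θ₆ : Real.Angle) (x : ReducedConfig) : Fin 6 → Real.Angle :=
  ![θ₁, x.1, ((2 * Real.arctan x.2.1.1 : ℝ) : Real.Angle),
    ((2 * Real.arctan x.2.1.2 : ℝ) : Real.Angle), ((2 * Real.arctan x.2.2 : ℝ) : Real.Angle), θ₆]

/-- `θ` is a midpoint over `q`: the quadratic form `B̃` has exactly two zeros over `q` on the circle,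
and `θ` has equal angle distance to both. -/
def IsMidpoint (q : ℝ × ℝ) (θ : Real.Angle) : Prop :=
  ∃ z w : Real.Angle, z ≠ w ∧ {φ | BP φ q = 0} = {z, w} ∧ dist θ z = dist θ w

end UR5

end

noncomputable section

namespace UR5

/-! ### The Jacobian -/

/-! The axes of joints 2, 3 and 4 are parallel. In a frame whose third axis has their direction,
these joints contribute only planar motions (rotation about that axis, translation across it), while
the other three twist coordinates involve only joints 1, 5 and 6. The Jacobian is therefore block
triangular. One block degenerates with `sin θ₃`, the other with `sin θ₅ * bigFactor`, which gives
`mem_singularSet_iff_factors`. In half-angle parameters `bigFactor` is `B̃` up to a positive factor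
(`BP_eq_mul_bigFactor`).

Every term of `bigFactor` is a pure first harmonic in `θ₂`. Over a point `q` of the `(v₃,
v₄)`-plane, `B̃` is thus `‖g‖ cos (θ₂ - δ)` with `g = gradient q` a plane vector of argument `δ`
(`BP_eq_norm_mul_cos`), and the discriminant is `4‖g‖²`. Where `g ≠ 0`, the zeros are the two
antipodal points `δ ± π/2`, the signs of `B̃` cut the circle into two open half circles, and their
centres `δ` and `δ + π` are the midpoints. All of these vary continuously with `q`. By
`coeffs_eq_zero_iff`, `g` vanishes at exactly two points, one on each side of `v₃ = 0`.

A half-plane minus a point is path connected, and rotating the midpoint to `0` turns each sign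
region over it into the product with a half circle (`isPathConnected_signedPiece`). Together with
the sign of `v₅`, the sign patterns give 8 open, disjoint, path connected pieces, which must be the
components (`connectedComponentIn_eq_of_partition`). The half-angle chart of the configuration space
misses only `θ₄ = π` within the non-singular set, since `θ₃ = π` and `θ₅ = π` are singular. As
non-singularity is an open condition, a small move of `θ₄` leaves that locus, so the 8 pieces
persist (`isPathConnected_configPiece`). -/

theorem _root_.Matrix.rank_lt_card_iff_exists_mulVec_eq_zero {m n K : Type*} [Fintype m] [Fintype n]
    [Field K] (M : Matrix m n K) :
    M.rank < Fintype.card n ↔ ∃ v ≠ 0, M.mulVec v = 0 := by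
  have h := LinearMap.finrank_range_add_finrank_ker M.mulVecLin
  rw [Module.finrank_fintype_fun_eq_card] at h
  have h1 : M.rank < Fintype.card n ↔ 0 < Module.finrank K (LinearMap.ker M.mulVecLin) := by
    rw [Matrix.rank]; omega
  rw [h1, Module.finrank_pos_iff, Submodule.nontrivial_iff_ne_bot, Submodule.ne_bot_iff]
  simp only [LinearMap.mem_ker, Matrix.mulVecLin_apply]
  exact ⟨fun ⟨x, hx, hx0⟩ => ⟨x, hx0, hx⟩, fun ⟨x, hx0, hx⟩ => ⟨x, hx, hx0⟩⟩

/-- The element of `se(3)` with angular velocity `(p, q, r)` and linear velocity `(x, y, z)`. -/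
def twistMatrix (p q r x y z : ℝ) : Matrix (Fin 4) (Fin 4) ℝ :=
  !![0, -r, q, x;
     r, 0, -p, y;
     -q, p, 0, z;
     0, 0, 0, 0]

/-- The Denavit-Hartenberg matrix, in terms of the cosines and sines of joint angle and twist. -/
def dhMatrix (c s cα sα a d : ℝ) : Matrix (Fin 4) (Fin 4) ℝ :=
  !![c, -s * cα, s * sα, a * c;
     s, c * cα, -c * sα, a * s;
     0, sα, cα, d;
     0, 0, 0, 1]

theorem joint_eq_dhMatrix (θ : Real.Angle) (d a α : ℝ) :
    rotZ θ * transZ d * transX a * rotX α =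
      dhMatrix θ.cos θ.sin (Real.cos α) (Real.sin α) a d := by
  ext i j
  fin_cases i <;> fin_cases j <;>
    simp [rotZ, transZ, transX, rotX, dhMatrix, Matrix.mul_apply, Fin.sum_univ_four] <;> ring

theorem isUnit_dhMatrix (c s cα sα a d : ℝ) (h : c ^ 2 + s ^ 2 = 1) (hα : cα ^ 2 + sα ^ 2 = 1) :
    IsUnit (dhMatrix c s cα sα a d) := by
  refine IsUnit.of_mul_eq_one !![c, s, 0, -a; -s * cα, c * cα, sα, -d * sα;
    s * sα, -c * sα, cα, -d * cα; 0, 0, 0, 1] ?_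
  ext i j
  fin_cases i <;> fin_cases j <;>
    simp [dhMatrix, Matrix.mul_apply, Fin.sum_univ_four] <;> grind

/-- This and the next three lemmas compute the adjoint action on `se(3)`. Twists of the first joints
are pushed to the right and twists of the last joints to the left, so that all of them meet between
the third and the fourth joint matrix. -/
theorem twistMatrix_mul_dhMatrix_zero (c s a p q r x y z : ℝ) (h : c ^ 2 + s ^ 2 = 1) :
    twistMatrix p q r x y z * dhMatrix c s 1 0 a 0 =
      dhMatrix c s 1 0 a 0 * twistMatrix (c * p + s * q) (c * q - s * p) r
        (c * x + s * y) (c * y - s * x + r * a) (z - a * (c * q - s * p)) := by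
  ext i j
  fin_cases i <;> fin_cases j <;>
    simp [dhMatrix, twistMatrix, Matrix.mul_apply, Fin.sum_univ_four] <;> grind

theorem twistMatrix_mul_dhMatrix_pi_div_two (c s : ℝ) :
    twistMatrix 0 0 1 0 0 0 * dhMatrix c s 0 1 0 0 =
      dhMatrix c s 0 1 0 0 * twistMatrix 0 1 0 0 0 0 := by
  ext i j
  fin_cases i <;> fin_cases j <;>
    simp [dhMatrix, twistMatrix, Matrix.mul_apply, Fin.sum_univ_four]

theorem dhMatrix_pi_div_two_mul_twistMatrix (c s d p q r x y z : ℝ) (h : c ^ 2 + s ^ 2 = 1) :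
    dhMatrix c s 0 1 0 d * twistMatrix p q r x y z =
      twistMatrix (c * p + s * r) (s * p - c * r) q
        (c * x + s * z - d * (s * p - c * r)) (s * x - c * z + d * (c * p + s * r)) y *
        dhMatrix c s 0 1 0 d := by
  ext i j
  fin_cases i <;> fin_cases j <;>
    simp [dhMatrix, twistMatrix, Matrix.mul_apply, Fin.sum_univ_four] <;> grind

theorem dhMatrix_neg_pi_div_two_mul_twistMatrix (c s d : ℝ) (h : c ^ 2 + s ^ 2 = 1) :
    dhMatrix c s 0 (-1) 0 d * twistMatrix 0 0 1 0 0 0 =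
      twistMatrix (-s) c 0 (-d * c) (-d * s) 0 * dhMatrix c s 0 (-1) 0 d := by
  ext i j
  fin_cases i <;> fin_cases j <;>
    simp [dhMatrix, twistMatrix, Matrix.mul_apply, Fin.sum_univ_four] <;> grind

theorem deriv_mul_rotZ_mul (P Q : Matrix (Fin 4) (Fin 4) ℝ) (θ : Real.Angle) (i j : Fin 4) :
    deriv (fun t : ℝ => (P * (rotZ (θ + (t : Real.Angle)) * Q)) i j) 0 =
      (P * (twistMatrix 0 0 1 0 0 0 * (rotZ θ * Q))) i j := by
  set D : Matrix (Fin 4) (Fin 4) ℝ := !![1, 0, 0, 0; 0, 1, 0, 0; 0, 0, 0, 0; 0, 0, 0, 0] with hD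
  -- Rotation by `t` is `cos t` times the projection `D` to the plane of rotation, plus `sin t`
  -- times the generator, plus the projection `1 - D` to the rest, which `rotZ θ` fixes. Only the
  -- sine term contributes to the derivative at `0`.
  have h (t : ℝ) : rotZ (θ + (t : Real.Angle)) =
      Real.cos t • (D * rotZ θ) + Real.sin t • (twistMatrix 0 0 1 0 0 0 * rotZ θ) + (1 - D) := by
    ext i j
    fin_cases i <;> fin_cases j <;>
      simp [rotZ, hD, twistMatrix, Real.Angle.cos_add, Real.Angle.sin_add] <;> ring
  have h1 (t : ℝ) : (P * (rotZ (θ + (t : Real.Angle)) * Q)) i j =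
      Real.cos t * (P * (D * rotZ θ * Q)) i j +
        Real.sin t * (P * (twistMatrix 0 0 1 0 0 0 * (rotZ θ * Q))) i j +
          (P * ((1 - D) * Q)) i j := by
    rw [h]
    simp only [add_mul, mul_add, Matrix.smul_mul, Matrix.mul_smul, Matrix.add_apply,
      Matrix.smul_apply, smul_eq_mul, Matrix.mul_assoc]
  simp_rw [h1]
  simp

/-- The matrix of the `i`-th joint of UR5. -/
def jointMatrix (θ : Fin 6 → Real.Angle) (i : Fin 6) : Matrix (Fin 4) (Fin 4) ℝ :=
  dhMatrix (θ i).cos (θ i).sin (![0, 1, 1, 0, 0, 1] i) (![1, 0, 0, 1, -1, 0] i)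
    (ur5.distance i) (ur5.offset i)

theorem jointMatrix_eq (θ : Fin 6 → Real.Angle) (i : Fin 6) :
    rotZ (θ i) * transZ (ur5.offset i) * transX (ur5.distance i) * rotX (ur5.twist i) =
      jointMatrix θ i := by
  rw [joint_eq_dhMatrix, jointMatrix]
  fin_cases i <;> simp [ur5, neg_div]

theorem isUnit_jointMatrix (θ : Fin 6 → Real.Angle) (i : Fin 6) : IsUnit (jointMatrix θ i) := by
  refine isUnit_dhMatrix _ _ _ _ _ _ (θ i).cos_sq_add_sin_sq ?_
  fin_cases i <;> simp

/-- The partial derivatives of the kinematic map of UR5. -/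
def partialDerivative (θ : Fin 6 → Real.Angle) : Fin 6 → Matrix (Fin 4) (Fin 4) ℝ :=
  let A := jointMatrix θ
  let Z := twistMatrix 0 0 1 0 0 0
  ![Z * (A 0 * (A 1 * (A 2 * (A 3 * (A 4 * A 5))))),
    A 0 * (Z * (A 1 * (A 2 * (A 3 * (A 4 * A 5))))),
    A 0 * (A 1 * (Z * (A 2 * (A 3 * (A 4 * A 5))))),
    A 0 * (A 1 * (A 2 * (Z * (A 3 * (A 4 * A 5))))),
    A 0 * (A 1 * (A 2 * (A 3 * (Z * (A 4 * A 5))))),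
    A 0 * (A 1 * (A 2 * (A 3 * (A 4 * (Z * A 5)))))]

theorem jacobian_ur5 (θ : Fin 6 → Real.Angle) (rc : Fin 4 × Fin 4) (i : Fin 6) :
    jacobian ur5 θ rc i = partialDerivative θ i rc.1 rc.2 := by
  have key (P Q : Matrix (Fin 4) (Fin 4) ℝ) (i : Fin 6) :
      deriv (fun t : ℝ => (P * (rotZ (θ i + (t : Real.Angle)) * (transZ (ur5.offset i) *
        (transX (ur5.distance i) * (rotX (ur5.twist i) * Q))))) rc.1 rc.2) 0 =
      (P * (twistMatrix 0 0 1 0 0 0 * (jointMatrix θ i * Q))) rc.1 rc.2 := by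
    rw [deriv_mul_rotZ_mul, ← jointMatrix_eq]
    simp only [Matrix.mul_assoc]
  have e : jacobian ur5 θ rc i = deriv (fun t : ℝ =>
      kinematicMap ur5 (Function.update θ i (θ i + (t : Real.Angle))) rc.1 rc.2) 0 := rfl
  rw [e]
  simp only [kinematicMap, List.ofFn_succ, List.ofFn_zero, List.prod_cons, List.prod_nil]
  have cases : ∀ i : Fin 6, deriv (fun t : ℝ => kinematicMap ur5
      (Function.update θ i (θ i + (t : Real.Angle))) rc.1 rc.2) 0 =
      partialDerivative θ i rc.1 rc.2 := by
    simp only [kinematicMap, List.ofFn_succ, List.ofFn_zero, List.prod_cons, List.prod_nil]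
    intro i
    set A := jointMatrix θ with hA
    fin_cases i
    · have := key (1) (A 1 * A 2 * A 3 * A 4 * A 5) 0
      simp only [hA, ← jointMatrix_eq, Matrix.mul_assoc, one_mul] at this
      simpa [partialDerivative, ← jointMatrix_eq, Matrix.mul_assoc, Function.update] using this
    · have := key (A 0) (A 2 * A 3 * A 4 * A 5) 1
      simp only [hA, ← jointMatrix_eq, Matrix.mul_assoc] at this
      simpa [partialDerivative, ← jointMatrix_eq, Matrix.mul_assoc, Function.update] using this
    · have := key (A 0 * A 1) (A 3 * A 4 * A 5) 2
      simp only [hA, ← jointMatrix_eq, Matrix.mul_assoc] at this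
      simpa [partialDerivative, ← jointMatrix_eq, Matrix.mul_assoc, Function.update] using this
    · have := key (A 0 * A 1 * A 2) (A 4 * A 5) 3
      simp only [hA, ← jointMatrix_eq, Matrix.mul_assoc] at this
      simpa [partialDerivative, ← jointMatrix_eq, Matrix.mul_assoc, Function.update] using this
    · have := key (A 0 * A 1 * A 2 * A 3) (A 5) 4
      simp only [hA, ← jointMatrix_eq, Matrix.mul_assoc] at this
      simpa [partialDerivative, ← jointMatrix_eq, Matrix.mul_assoc, Function.update] using this
    · have := key (A 0 * A 1 * A 2 * A 3 * A 4) (1) 5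
      simp only [hA, ← jointMatrix_eq, Matrix.mul_assoc, mul_one] at this
      simpa [partialDerivative, ← jointMatrix_eq, Matrix.mul_assoc, Function.update] using this
  exact cases i

theorem mem_singularSet_iff (θ : Fin 6 → Real.Angle) :
    θ ∈ singularSet ur5 ↔ ∃ k : Fin 6 → ℝ, k ≠ 0 ∧ ∑ i, k i • partialDerivative θ i = 0 := by
  have h := Matrix.rank_lt_card_iff_exists_mulVec_eq_zero (jacobian ur5 θ)
  rw [Fintype.card_fin] at h
  rw [singularSet, Set.mem_ofPred_eq, h]
  refine exists_congr fun k => and_congr_right fun _ => ?_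
  rw [← Matrix.ext_iff, funext_iff, Prod.forall]
  simp only [Matrix.mulVec, dotProduct, jacobian_ur5, Matrix.sum_apply, Matrix.smul_apply,
    smul_eq_mul, mul_comm, Pi.zero_apply, Matrix.zero_apply]

/-- The sum of the twists of the joints, weighted by `k`, in the frame of the fourth joint. -/
theorem sum_smul_partialDerivative (θ : Fin 6 → Real.Angle) (k : Fin 6 → ℝ) :
    ∑ i, k i • partialDerivative θ i =
      jointMatrix θ 0 * jointMatrix θ 1 * jointMatrix θ 2 *
        twistMatrix
          (k 0 * (θ 1 + θ 2).sin + k 4 * (θ 3).sin - k 5 * ((θ 4).sin * (θ 3).cos))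
          (k 0 * (θ 1 + θ 2).cos - k 4 * (θ 3).cos - k 5 * ((θ 4).sin * (θ 3).sin))
          (k 1 + k 2 + k 3 + k 5 * (θ 4).cos)
          (k 1 * (-425 / 1000 * (θ 2).sin) + k 4 * (10915 / 100000 * (θ 3).cos) +
            k 5 * (10915 / 100000 * (θ 4).sin * (θ 3).sin -
              9465 / 100000 * (θ 4).cos * (θ 3).cos))
          (k 1 * (-425 / 1000 * (θ 2).cos - 39225 / 100000) + k 2 * (-39225 / 100000) +
            k 4 * (10915 / 100000 * (θ 3).sin) -
            k 5 * (10915 / 100000 * (θ 4).sin * (θ 3).cos +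
              9465 / 100000 * (θ 4).cos * (θ 3).sin))
          (-k 0 * (-425 / 1000 * (θ 1).cos - 39225 / 100000 * (θ 1 + θ 2).cos) -
            k 5 * (9465 / 100000 * (θ 4).sin)) *
        (jointMatrix θ 3 * jointMatrix θ 4 * jointMatrix θ 5) := by
  have assoc {M N P Q : Matrix (Fin 4) (Fin 4) ℝ} (h : M * N = P * Q)
      (X : Matrix (Fin 4) (Fin 4) ℝ) : M * (N * X) = P * (Q * X) := by
    rw [← Matrix.mul_assoc, h, Matrix.mul_assoc]
  have a0 : jointMatrix θ 0 = dhMatrix (θ 0).cos (θ 0).sin 0 1 0 0 := by simp [jointMatrix, ur5]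
  have a1 : jointMatrix θ 1 = dhMatrix (θ 1).cos (θ 1).sin 1 0 (-425 / 1000) 0 := by
    simp [jointMatrix, ur5]
  have a2 : jointMatrix θ 2 = dhMatrix (θ 2).cos (θ 2).sin 1 0 (-39225 / 100000) 0 := by
    simp [jointMatrix, ur5]
  have a3 : jointMatrix θ 3 = dhMatrix (θ 3).cos (θ 3).sin 0 1 0 (10915 / 100000) := by
    simp [jointMatrix, ur5]
  have a4 : jointMatrix θ 4 = dhMatrix (θ 4).cos (θ 4).sin 0 (-1) 0 (9465 / 100000) := by
    simp [jointMatrix, ur5]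
  have h1 := (θ 1).cos_sq_add_sin_sq
  have h2 := (θ 2).cos_sq_add_sin_sq
  have h3 := (θ 3).cos_sq_add_sin_sq
  have h4 := (θ 4).cos_sq_add_sin_sq
  have t0 := twistMatrix_mul_dhMatrix_pi_div_two (θ 0).cos (θ 0).sin
  have t1 (p q r x y z) := twistMatrix_mul_dhMatrix_zero _ _ (-425 / 1000) p q r x y z h1
  have t2 (p q r x y z) := twistMatrix_mul_dhMatrix_zero _ _ (-39225 / 100000) p q r x y z h2
  have t3 (p q r x y z) := dhMatrix_pi_div_two_mul_twistMatrix _ _ (10915 / 100000) p q r x y z h3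
  have t4 := dhMatrix_neg_pi_div_two_mul_twistMatrix _ _ (9465 / 100000) h4
  rw [← a0] at t0
  rw [← a1] at t1
  rw [← a2] at t2
  rw [← a3] at t3
  rw [← a4] at t4
  set L := jointMatrix θ 0 * jointMatrix θ 1 * jointMatrix θ 2 with hL
  set R := jointMatrix θ 3 * jointMatrix θ 4 * jointMatrix θ 5 with hR
  -- All six derivatives take the form `L * (twist * R)` with the same `L` and `R`, so a linear
  -- relation between them is one between the twists.
  have d0 : partialDerivative θ 0 = L * (twistMatrix (θ 1 + θ 2).sin (θ 1 + θ 2).cos 0 0 0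
      (-(-425 / 1000 * (θ 1).cos - 39225 / 100000 * (θ 1 + θ 2).cos)) * R) := by
    simp only [partialDerivative, Matrix.cons_val, hL, hR, Matrix.mul_assoc]
    rw [assoc t0, assoc (t1 _ _ _ _ _ _), assoc (t2 _ _ _ _ _ _), Real.Angle.sin_add,
      Real.Angle.cos_add]
    ring_nf
  have d1 : partialDerivative θ 1 = L * (twistMatrix 0 0 1 (-425 / 1000 * (θ 2).sin)
      (-425 / 1000 * (θ 2).cos - 39225 / 100000) 0 * R) := by
    simp only [partialDerivative, Matrix.cons_val, hL, hR, Matrix.mul_assoc]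
    rw [assoc (t1 _ _ _ _ _ _), assoc (t2 _ _ _ _ _ _)]
    ring_nf
  have d2 : partialDerivative θ 2 = L * (twistMatrix 0 0 1 0 (-39225 / 100000) 0 * R) := by
    simp only [partialDerivative, Matrix.cons_val, hL, hR, Matrix.mul_assoc]
    rw [assoc (t2 _ _ _ _ _ _)]
    ring_nf
  have d3 : partialDerivative θ 3 = L * (twistMatrix 0 0 1 0 0 0 * R) := by
    simp only [partialDerivative, Matrix.cons_val, hL, hR, Matrix.mul_assoc]
  have d4 : partialDerivative θ 4 = L * (twistMatrix (θ 3).sin (-(θ 3).cos) 0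
      (10915 / 100000 * (θ 3).cos) (10915 / 100000 * (θ 3).sin) 0 * R) := by
    simp only [partialDerivative, Matrix.cons_val, hL, hR, Matrix.mul_assoc]
    rw [assoc (t3 _ _ _ _ _ _)]
    ring_nf
  have d5 : partialDerivative θ 5 = L * (twistMatrix (-((θ 4).sin * (θ 3).cos))
      (-((θ 4).sin * (θ 3).sin)) (θ 4).cos
      (10915 / 100000 * (θ 4).sin * (θ 3).sin - 9465 / 100000 * (θ 4).cos * (θ 3).cos)
      (-(10915 / 100000 * (θ 4).sin * (θ 3).cos + 9465 / 100000 * (θ 4).cos * (θ 3).sin))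
      (-(9465 / 100000 * (θ 4).sin)) * R) := by
    simp only [partialDerivative, Matrix.cons_val, hL, hR, Matrix.mul_assoc]
    rw [assoc t4, assoc (t3 _ _ _ _ _ _)]
    ring_nf
  have hs (T : Fin 6 → Matrix (Fin 4) (Fin 4) ℝ)
      (hT : ∀ i, partialDerivative θ i = L * (T i * R)) :
      ∑ i, k i • partialDerivative θ i = L * (∑ i, k i • T i) * R := by
    simp only [hT, Finset.mul_sum, Finset.sum_mul, Matrix.mul_smul, Matrix.smul_mul,
      Matrix.mul_assoc]
  rw [hs ![_, _, _, _, _, _] (by intro i; fin_cases i; exacts [d0, d1, d2, d3, d4, d5])]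
  congr 2
  ext i j
  fin_cases i <;> fin_cases j <;> simp [twistMatrix, Fin.sum_univ_six] <;> ring

/-- The determinant of the Jacobian vanishes with one of three factors; this is the large one. -/
def bigFactor (θ₂ θ₃ θ₄ : Real.Angle) : ℝ :=
  425 / 1000 * θ₂.cos + 39225 / 100000 * (θ₂ + θ₃).cos - 9465 / 100000 * (θ₂ + θ₃ + θ₄).sin

theorem twistMatrix_eq_zero_iff (p q r x y z : ℝ) :
    twistMatrix p q r x y z = 0 ↔ p = 0 ∧ q = 0 ∧ r = 0 ∧ x = 0 ∧ y = 0 ∧ z = 0 := by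
  constructor
  · intro h
    have e (i j) : twistMatrix p q r x y z i j = 0 := by rw [h]; rfl
    exact ⟨by simpa [twistMatrix] using e 2 1, by simpa [twistMatrix] using e 0 2,
      by simpa [twistMatrix] using e 1 0, by simpa [twistMatrix] using e 0 3,
      by simpa [twistMatrix] using e 1 3, by simpa [twistMatrix] using e 2 3⟩
  · rintro ⟨rfl, rfl, rfl, rfl, rfl, rfl⟩
    ext i j
    fin_cases i <;> fin_cases j <;> simp [twistMatrix]

theorem sum_smul_partialDerivative_eq_zero_iff (θ : Fin 6 → Real.Angle) (k : Fin 6 → ℝ) :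
    ∑ i, k i • partialDerivative θ i = 0 ↔
      k 0 * (θ 1 + θ 2).sin + k 4 * (θ 3).sin - k 5 * ((θ 4).sin * (θ 3).cos) = 0 ∧
      k 0 * (θ 1 + θ 2).cos - k 4 * (θ 3).cos - k 5 * ((θ 4).sin * (θ 3).sin) = 0 ∧
      k 1 + k 2 + k 3 + k 5 * (θ 4).cos = 0 ∧
      k 1 * (-425 / 1000 * (θ 2).sin) + k 4 * (10915 / 100000 * (θ 3).cos) +
        k 5 * (10915 / 100000 * (θ 4).sin * (θ 3).sin -
          9465 / 100000 * (θ 4).cos * (θ 3).cos) = 0 ∧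
      k 1 * (-425 / 1000 * (θ 2).cos - 39225 / 100000) + k 2 * (-39225 / 100000) +
        k 4 * (10915 / 100000 * (θ 3).sin) -
        k 5 * (10915 / 100000 * (θ 4).sin * (θ 3).cos +
          9465 / 100000 * (θ 4).cos * (θ 3).sin) = 0 ∧
      -k 0 * (-425 / 1000 * (θ 1).cos - 39225 / 100000 * (θ 1 + θ 2).cos) -
        k 5 * (9465 / 100000 * (θ 4).sin) = 0 := by
  have hL : IsUnit (jointMatrix θ 0 * jointMatrix θ 1 * jointMatrix θ 2) :=
    ((isUnit_jointMatrix θ 0).mul (isUnit_jointMatrix θ 1)).mul (isUnit_jointMatrix θ 2)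
  have hR : IsUnit (jointMatrix θ 3 * jointMatrix θ 4 * jointMatrix θ 5) :=
    ((isUnit_jointMatrix θ 3).mul (isUnit_jointMatrix θ 4)).mul (isUnit_jointMatrix θ 5)
  rw [sum_smul_partialDerivative, hR.mul_left_eq_zero, hL.mul_right_eq_zero,
    twistMatrix_eq_zero_iff]

/-- The weights `k 1`, `k 2`, `k 3` of the parallel joints occur only in the equations 3, 4, 5. The
equations 1, 2, 6 form a closed system for `k 0`, `k 4`, `k 5`, with determinant `(θ 4).sin` times
`bigFactor` up to sign. The remaining block is invertible exactly if `(θ 2).sin ≠ 0`. -/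
theorem mem_singularSet_iff_factors (θ : Fin 6 → Real.Angle) :
    θ ∈ singularSet ur5 ↔
      bigFactor (θ 1) (θ 2) (θ 3) = 0 ∨ (θ 2).sin = 0 ∨ (θ 4).sin = 0 := by
  rw [mem_singularSet_iff]
  simp only [sum_smul_partialDerivative_eq_zero_iff]
  have hw : (θ 1 + θ 2 + θ 3).sin =
      (θ 1 + θ 2).sin * (θ 3).cos + (θ 1 + θ 2).cos * (θ 3).sin := Real.Angle.sin_add _ _
  have h3 := (θ 3).cos_sq_add_sin_sq
  rw [bigFactor, hw]
  generalize (θ 1 + θ 2).sin = s12 at *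
  generalize (θ 1 + θ 2).cos = c12 at *
  generalize (θ 1).cos = c1 at *
  generalize (θ 2).sin = s2 at *
  generalize (θ 2).cos = c2 at *
  generalize (θ 3).sin = s3 at *
  generalize (θ 3).cos = c3 at *
  generalize (θ 4).sin = s4 at *
  generalize (θ 4).cos = c4 at *
  constructor
  · rintro ⟨k, hk, e1, e2, e3, e4, e5, e6⟩
    by_contra! h
    obtain ⟨hG, hs2, hs4⟩ := h
    have k0 : k 0 = 0 := by
      -- The combination `c3 * e1 + s3 * e2` eliminates `k 4` and expresses `k 5 * s4` through `k
      -- 0`; inserting this in `e6` leaves `k 0` times the big factor.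
      have : k 0 * (425 / 1000 * c1 + 39225 / 100000 * c12 -
          9465 / 100000 * (s12 * c3 + c12 * s3)) = 0 := by
        linear_combination e6 - 9465 / 100000 * (c3 * e1 + s3 * e2) -
          9465 / 100000 * k 5 * s4 * h3
      exact (mul_eq_zero.1 this).resolve_right hG
    have k5 : k 5 = 0 := by
      rw [k0] at e6
      have : k 5 * s4 = 0 := by linarith
      exact (mul_eq_zero.1 this).resolve_right hs4
    have k4 : k 4 = 0 := by
      rw [k0, k5] at e1 e2
      linear_combination s3 * e1 - c3 * e2 - k 4 * h3
    have k1 : k 1 = 0 := by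
      rw [k4, k5] at e4
      have : k 1 * s2 = 0 := by linarith
      exact (mul_eq_zero.1 this).resolve_right hs2
    have k2 : k 2 = 0 := by
      rw [k4, k5, k1] at e5
      linarith
    have k3 : k 3 = 0 := by
      rw [k1, k2, k5] at e3
      linarith
    refine hk (funext fun i => ?_)
    fin_cases i <;> simpa
  · intro h
    by_cases hs2 : s2 = 0
    · refine ⟨![0, 39225 / 100000, -425 / 1000 * c2 - 39225 / 100000, 425 / 1000 * c2, 0, 0],
        fun h0 => by simpa using congrFun h0 1, ?_⟩
      simp [hs2]
      constructor <;> ring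
    -- the three parallel joints compensate any planar motion
    have solve (a b d : ℝ) : ∃ x y z : ℝ, x + y + z = a ∧ x * (-425 / 1000 * s2) = b ∧
        x * (-425 / 1000 * c2 - 39225 / 100000) + y * (-39225 / 100000) = d := by
      set x := b / (-425 / 1000 * s2) with hx
      set y := (d - x * (-425 / 1000 * c2 - 39225 / 100000)) / (-39225 / 100000) with hy
      refine ⟨x, y, a - x - y, by ring, ?_, ?_⟩
      · rw [hx]; field_simp
      · rw [hy]; field_simp; ring
    by_cases hs4 : s4 = 0
    -- Here the sixth axis is parallel to the three parallel axes, so its motion is planar and they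
    -- compensate it.
    · obtain ⟨x, y, z, h1, h2, h4⟩ := solve (-c4) (9465 / 100000 * c4 * c3)
        (9465 / 100000 * c4 * s3)
      refine ⟨![0, x, y, z, 0, 1], fun h0 => by simpa using congrFun h0 5, ?_⟩
      simp only [Matrix.cons_val, hs4]
      refine ⟨by ring, by ring, ?_, ?_, ?_, by ring⟩ <;> linarith
    · have hG := (h.resolve_right (by tauto))
      -- With `k 0 = 1`, the equations 1 and 2 force `k 5 = f` and `k 4 = g`. The sixth equation is
      -- then the vanishing of the big factor, and `solve` settles the other three.
      set f := (s12 * c3 + c12 * s3) / s4 with hf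
      have hf' : f * s4 = s12 * c3 + c12 * s3 := by rw [hf]; field_simp
      set g := c12 * c3 - s12 * s3 with hg
      obtain ⟨x, y, z, h1, h2, h4⟩ := solve (-f * c4)
        (-(g * (10915 / 100000 * c3) +
          f * (10915 / 100000 * s4 * s3 - 9465 / 100000 * c4 * c3)))
        (-(g * (10915 / 100000 * s3)) +
          f * (10915 / 100000 * s4 * c3 + 9465 / 100000 * c4 * s3))
      refine ⟨![1, x, y, z, g, f], fun h0 => by simpa using congrFun h0 0, ?_⟩
      simp only [Matrix.cons_val]
      refine ⟨?_, ?_, ?_, ?_, ?_, ?_⟩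
      · linear_combination (-s12) * h3 - c3 * hf'
      · linear_combination (-c12) * h3 - s3 * hf'
      · linear_combination h1
      · linear_combination h2
      · linear_combination h4
      · linear_combination hG - 9465 / 100000 * hf'

/-! ### The coefficients and the discriminant -/

/-- The constant coefficient of `B̃`. -/
def constCoeff (q : ℝ × ℝ) : ℝ :=
  (425 / 1000 - 39225 / 100000) * q.1 ^ 2 * q.2 ^ 2 + 18930 / 100000 * q.1 ^ 2 * q.2
    + 18930 / 100000 * q.1 * q.2 ^ 2 + (425 / 1000 - 39225 / 100000) * q.1 ^ 2
    + (425 / 1000 + 39225 / 100000) * q.2 ^ 2 - 18930 / 100000 * q.1 - 18930 / 100000 * q.2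
    + (425 / 1000 + 39225 / 100000)

/-- The linear coefficient of `B̃`. -/
def linCoeff (q : ℝ × ℝ) : ℝ :=
  -18930 / 100000 * q.1 ^ 2 * q.2 ^ 2 - 156900 / 100000 * q.1 * q.2 ^ 2
    + 18930 / 100000 * q.1 ^ 2 + 75720 / 100000 * q.1 * q.2 + 18930 / 100000 * q.2 ^ 2
    - 156900 / 100000 * q.1 - 18930 / 100000

-- The coefficients of `v₂ ^ 2` and `1` are opposite. This symmetry is what makes `B̃` a pure first
-- harmonic in `θ₂`.
open Polynomial in
theorem exists_Btilde_eq :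
    ∃ p₀ p₁ : MvPolynomial (Fin 2) ℝ, Btilde = C (-p₀) * X ^ 2 + C p₁ * X + C p₀ ∧
      ∀ q : ℝ × ℝ, MvPolynomial.eval ![q.1, q.2] p₀ = constCoeff q ∧
        MvPolynomial.eval ![q.1, q.2] p₁ = linCoeff q := by
  set a : MvPolynomial (Fin 2) ℝ := MvPolynomial.C (-425 / 1000) with ha
  set b : MvPolynomial (Fin 2) ℝ := MvPolynomial.C (-39225 / 100000) with hb
  set d : MvPolynomial (Fin 2) ℝ := MvPolynomial.C (9465 / 100000) with hd
  set x : MvPolynomial (Fin 2) ℝ := MvPolynomial.X 0 with hx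
  set y : MvPolynomial (Fin 2) ℝ := MvPolynomial.X 1 with hy
  refine ⟨-a * x ^ 2 * y ^ 2 + b * x ^ 2 * y ^ 2 + 2 * d * x ^ 2 * y + 2 * d * x * y ^ 2
    - a * x ^ 2 - a * y ^ 2 + b * x ^ 2 - b * y ^ 2 - 2 * d * x - 2 * d * y - a - b,
    -2 * d * x ^ 2 * y ^ 2 + 4 * b * x * y ^ 2 + 2 * d * x ^ 2 + 8 * d * x * y + 2 * d * y ^ 2
    + 4 * b * x - 2 * d, ?_, fun q => ⟨?_, ?_⟩⟩
  · rw [Btilde, ← ha, ← hb, ← hd, ← hx, ← hy, urB]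
    simp only [map_add, map_sub, map_mul, map_neg, map_pow, map_ofNat]
    ring
  · simp [ha, hb, hd, hx, hy, constCoeff]
    ring
  · simp [hb, hd, hx, hy, linCoeff]
    ring

theorem Bcoeff_zero (q : ℝ × ℝ) : Bcoeff 0 q = constCoeff q := by
  obtain ⟨p₀, p₁, h, hq⟩ := exists_Btilde_eq
  simp [Bcoeff, h, ← (hq q).1]

theorem Bcoeff_one (q : ℝ × ℝ) : Bcoeff 1 q = linCoeff q := by
  obtain ⟨p₀, p₁, h, hq⟩ := exists_Btilde_eq
  simp only [Bcoeff, h, ← (hq q).2, Polynomial.coeff_add, Polynomial.coeff_C_mul,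
    Polynomial.coeff_X_pow, Polynomial.coeff_X, Polynomial.coeff_C]
  simp

theorem Bcoeff_two (q : ℝ × ℝ) : Bcoeff 2 q = -constCoeff q := by
  obtain ⟨p₀, p₁, h, hq⟩ := exists_Btilde_eq
  simp only [Bcoeff, h, ← (hq q).1, Polynomial.coeff_add, Polynomial.coeff_C_mul,
    Polynomial.coeff_X_pow, Polynomial.coeff_X, Polynomial.coeff_C]
  simp

theorem Bcoeff_eq_zero_of_two_lt {k : ℕ} (hk : 2 < k) (q : ℝ × ℝ) : Bcoeff k q = 0 := by
  rw [Bcoeff, Polynomial.coeff_eq_zero_of_natDegree_lt (Btilde_natDegree_le.trans_lt hk), map_zero]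

/-- Because `b₂ = -b₀`, the terms of the quadratic form that do not depend on the double angle
cancel. -/
theorem BP_eq (θ : Real.Angle) (q : ℝ × ℝ) :
    BP θ q = constCoeff q * θ.cos + linCoeff q / 2 * θ.sin := by
  rw [BP, Bcoeff_zero, Bcoeff_one, Bcoeff_two]
  ring

theorem eval_discr (q : ℝ × ℝ) :
    MvPolynomial.eval ![q.1, q.2] (Polynomial.discr Btilde) =
      linCoeff q ^ 2 + 4 * constCoeff q ^ 2 := by
  obtain ⟨p₀, p₁, h, hq⟩ := exists_Btilde_eq
  -- The quadratic formula for `Polynomial.discr` requires degree exactly 2, so the leading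
  -- coefficient must be a non-zero polynomial; its value at the origin shows this.
  have hp : -p₀ ≠ 0 := by
    intro h0
    have h1 := (hq (0, 0)).1
    rw [neg_eq_zero.1 h0, map_zero] at h1
    norm_num [constCoeff] at h1
  have h2 : Btilde.degree = 2 := by
    rw [h, Polynomial.degree_quadratic hp]
  rw [Polynomial.discr_of_degree_eq_two h2]
  simp only [map_sub, map_mul, map_pow, map_ofNat]
  have e0 := Bcoeff_zero q
  have e1 := Bcoeff_one q
  have e2 := Bcoeff_two q
  simp only [Bcoeff] at e0 e1 e2
  rw [e0, e1, e2]
  ring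

theorem mvPolynomial_ext_pair {p r : MvPolynomial (Fin 2) ℝ}
    (h : ∀ q : ℝ × ℝ, MvPolynomial.eval ![q.1, q.2] p = MvPolynomial.eval ![q.1, q.2] r) :
    p = r := by
  refine MvPolynomial.funext fun x => ?_
  have e : x = ![x 0, x 1] := by ext i; fin_cases i <;> rfl
  rw [e]
  exact h (x 0, x 1)

theorem linCoeff_sq_add (q : ℝ × ℝ) :
    linCoeff q ^ 2 + 4 * constCoeff q ^ 2 =
      1 / 50000000 * (1 + q.1 ^ 2) * (1 + q.2 ^ 2) *
        (((1577212 * q.1 - 3561263 * q.2 - 14850585) ^ 2 +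
          ((2006237 * q.2 + 1239915) * q.1 + 16090500 * q.2 - 7144712) ^ 2) / 2006237) := by
  rw [linCoeff, constCoeff]
  ring

theorem discr_Btilde :
    Polynomial.discr Btilde =
      MvPolynomial.C (1 / 50000000) * (1 + MvPolynomial.X 0 ^ 2) * (1 + MvPolynomial.X 1 ^ 2) *
        (cPoly ^ 2 + dPoly ^ 2) := by
  refine mvPolynomial_ext_pair fun q => ?_
  rw [eval_discr, linCoeff_sq_add]
  simp only [cPoly, dPoly, map_add, map_sub, map_mul, map_pow, map_one, MvPolynomial.eval_C,
    MvPolynomial.eval_X, mul_pow, inv_pow, Real.sq_sqrt (show (0 : ℝ) ≤ 2006237 by norm_num),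
    Matrix.cons_val]
  ring

theorem discr_Btilde_eq_sq_add_sq :
    ∃ e f : MvPolynomial (Fin 2) ℝ, Polynomial.discr Btilde = e ^ 2 + f ^ 2 := by
  set k : MvPolynomial (Fin 2) ℝ := MvPolynomial.C (Real.sqrt (1 / 50000000)) with hk
  have hk2 : MvPolynomial.C (1 / 50000000) = k ^ 2 := by
    rw [hk, ← map_pow, Real.sq_sqrt (by norm_num)]
  set x : MvPolynomial (Fin 2) ℝ := MvPolynomial.X 0
  set y : MvPolynomial (Fin 2) ℝ := MvPolynomial.X 1
  refine ⟨k * ((1 - x * y) * cPoly - (x + y) * dPoly),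
    k * ((1 - x * y) * dPoly + (x + y) * cPoly), ?_⟩
  rw [discr_Btilde, hk2]
  ring

/-! ### The common zeros of the coefficients -/

/-- The points over which `B̃` vanishes identically, one for each sign of `v₃`. -/
def pole (ε : ℤˣ) : ℝ × ℝ :=
  let t := ((ε : ℤ) : ℝ) * Real.sqrt (32946947 / 394303)
  (t, (1577212 * t - 14850585) / 3561263)

theorem sqrt_bounds : 9.1409755635 < Real.sqrt (32946947 / 394303) ∧
    Real.sqrt (32946947 / 394303) < 9.140975564 := by
  constructor
  · apply Real.lt_sqrt_of_sq_lt
    norm_num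
  · rw [Real.sqrt_lt' (by norm_num)]
    norm_num

theorem pole_fst_pos (ε : ℤˣ) : 0 < ((ε : ℤ) : ℝ) * (pole ε).1 := by
  rcases Int.units_eq_one_or ε with rfl | rfl <;> simp [pole]

theorem pole_bounds :
    |(pole (-1)).1 + 9.140975564| < 1 / 10 ^ 8 ∧ |(pole (-1)).2 + 8.218388067| < 1 / 10 ^ 8 ∧
      |(pole 1).1 - 9.140975563| < 1 / 10 ^ 8 ∧ |(pole 1).2 + 0.1216783622| < 1 / 10 ^ 8 := by
  obtain ⟨h1, h2⟩ := sqrt_bounds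
  simp only [pole, Units.val_neg, Units.val_one, Int.cast_neg, Int.cast_one, abs_lt]
  generalize Real.sqrt (32946947 / 394303) = s at *
  refine ⟨⟨?_, ?_⟩, ⟨?_, ?_⟩, ⟨?_, ?_⟩, ⟨?_, ?_⟩⟩ <;> linarith

/-- A real sum of two squares vanishes only if both do. The equation `c = 0` is linear and gives
`v₄` in terms of `v₃`. Inserted in `d = 0`, the linear term cancels and `v₃² = 32946947 / 394303`
remains. -/
theorem coeffs_eq_zero_iff (q : ℝ × ℝ) :
    linCoeff q ^ 2 + 4 * constCoeff q ^ 2 = 0 ↔ q = pole (-1) ∨ q = pole 1 := by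
  have hs : Real.sqrt (32946947 / 394303) ^ 2 = 32946947 / 394303 := Real.sq_sqrt (by norm_num)
  rw [linCoeff_sq_add]
  simp only [pole, Units.val_neg, Units.val_one, Int.cast_neg, Int.cast_one, Prod.ext_iff]
  generalize Real.sqrt (32946947 / 394303) = s at *
  obtain ⟨x, y⟩ := q
  dsimp only
  constructor
  · intro h
    have hx : 0 < 1 / 50000000 * (1 + x ^ 2) * (1 + y ^ 2) := by positivity
    have h1 := (mul_eq_zero.1 h).resolve_left hx.ne'
    have h2 := (div_eq_zero_iff.1 h1).resolve_right (by norm_num)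
    have hc : 1577212 * x - 3561263 * y - 14850585 = 0 := by
      nlinarith [sq_nonneg (1577212 * x - 3561263 * y - 14850585),
        sq_nonneg ((2006237 * y + 1239915) * x + 16090500 * y - 7144712)]
    have hd : (2006237 * y + 1239915) * x + 16090500 * y - 7144712 = 0 := by
      rw [hc] at h2
      simpa using h2
    have hy : y = (1577212 * x - 14850585) / 3561263 := by linarith
    have hx2 : (x + s) * (x - s) = 0 := by
      rw [hy] at hd
      -- The denominator is `2006237 * 1577212`, from the leading coefficient after substitution.
      linear_combination (3561263 / 3164261071244) * hd - hs
    rcases mul_eq_zero.1 hx2 with h | h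
    · have hxs : x = -1 * s := by linarith
      exact Or.inl ⟨hxs, by rw [hy, hxs]⟩
    · have hxs : x = 1 * s := by linarith
      exact Or.inr ⟨hxs, by rw [hy, hxs]⟩
  · have key (t : ℝ) (ht : t ^ 2 = 32946947 / 394303) (hx : x = t)
        (hy : y = (1577212 * t - 14850585) / 3561263) :
        1 / 50000000 * (1 + x ^ 2) * (1 + y ^ 2) * (((1577212 * x - 3561263 * y - 14850585) ^ 2 +
          ((2006237 * y + 1239915) * x + 16090500 * y - 7144712) ^ 2) / 2006237) = 0 := by
      have hc : 1577212 * x - 3561263 * y - 14850585 = 0 := by rw [hx, hy]; ring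
      have hd : (2006237 * y + 1239915) * x + 16090500 * y - 7144712 = 0 := by
        rw [hx, hy]
        linear_combination (3164261071244 / 3561263) * ht
      rw [hc, hd]
      ring
    rintro (⟨hx, hy⟩ | ⟨hx, hy⟩)
    · exact key _ (by linear_combination hs) hx hy
    · exact key _ (by linear_combination hs) hx hy

theorem Bcoeff_pole (ε : ℤˣ) (k : ℕ) : Bcoeff k (pole ε) = 0 := by
  have h := (coeffs_eq_zero_iff (pole ε)).2
    (by rcases Int.units_eq_one_or ε with rfl | rfl <;> simp)
  have h1 : linCoeff (pole ε) = 0 := by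
    nlinarith [sq_nonneg (linCoeff (pole ε)), sq_nonneg (constCoeff (pole ε))]
  have h0 : constCoeff (pole ε) = 0 := by
    rw [h1] at h
    simpa using h
  match k with
  | 0 => rw [Bcoeff_zero, h0]
  | 1 => rw [Bcoeff_one, h1]
  | 2 => rw [Bcoeff_two, h0, neg_zero]
  | k + 3 => exact Bcoeff_eq_zero_of_two_lt (by omega) _

/-- In the half-angle parameters, `bigFactor` is `B̃` up to a positive factor. -/
theorem BP_eq_mul_bigFactor (θ : Real.Angle) (x y : ℝ) :
    BP θ (x, y) = (1 + x ^ 2) * (1 + y ^ 2) *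
      bigFactor θ ((2 * Real.arctan x : ℝ) : Real.Angle) ((2 * Real.arctan y : ℝ) : Real.Angle) := by
  have hs (v : ℝ) : Real.sin (2 * Real.arctan v) = 2 * v / (1 + v ^ 2) := by
    have hp : 0 < 1 + v ^ 2 := by positivity
    rw [Real.sin_two_mul, Real.sin_arctan, Real.cos_arctan]
    have := Real.sq_sqrt hp.le
    have h0 : Real.sqrt (1 + v ^ 2) ≠ 0 := (Real.sqrt_pos.2 hp).ne'
    field_simp
    rw [this]
  have hc (v : ℝ) : Real.cos (2 * Real.arctan v) = (1 - v ^ 2) / (1 + v ^ 2) := by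
    have hp : 0 < 1 + v ^ 2 := by positivity
    rw [Real.cos_two_mul, Real.cos_sq_arctan]
    field_simp
    ring
  have hx : 1 + x ^ 2 ≠ 0 := by positivity
  have hy : 1 + y ^ 2 ≠ 0 := by positivity
  rw [BP_eq, bigFactor, linCoeff, constCoeff]
  simp only [Real.Angle.sin_add, Real.Angle.cos_add, Real.Angle.sin_coe, Real.Angle.cos_coe, hs, hc]
  field_simp
  ring

theorem sin_two_arctan_mul_pos_iff (ε v : ℝ) :
    0 < ε * (((2 * Real.arctan v : ℝ) : Real.Angle)).sin ↔ 0 < ε * v := by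
  have hp : 0 < 2 * Real.cos (Real.arctan v) ^ 2 := by
    have := Real.cos_arctan_pos v
    positivity
  have h : Real.sin (2 * Real.arctan v) = v * (2 * Real.cos (Real.arctan v) ^ 2) := by
    have h1 := Real.tan_mul_cos (Real.cos_arctan_pos v).ne'
    rw [Real.tan_arctan] at h1
    rw [Real.sin_two_mul, ← h1]
    ring
  rw [Real.Angle.sin_coe, h, ← mul_assoc, mul_pos_iff_of_pos_right hp]

/-! ### Angles -/

/-- Turns equality of angle distances into an equation of cosines: the norm is the absolute value of
the representative in `(-π, π]`, and the cosine determines an angle up to sign. -/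
theorem norm_angle_eq_norm_iff (a b : Real.Angle) : ‖a‖ = ‖b‖ ↔ a.cos = b.cos := by
  have h (c : Real.Angle) : ‖c‖ = |c.toReal| := by
    have h1 : ‖((c.toReal : ℝ) : AddCircle (2 * Real.pi))‖ = |c.toReal| := by
      rw [AddCircle.norm_coe_eq_abs_iff _ Real.two_pi_pos.ne', abs_of_pos Real.two_pi_pos]
      linarith [c.abs_toReal_le_pi]
    rw [← h1]
    exact congrArg norm c.coe_toReal.symm
  constructor
  · intro hab
    rw [h, h] at hab
    rw [← Real.Angle.cos_toReal a, ← Real.Angle.cos_toReal b, ← Real.cos_abs a.toReal, hab,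
      Real.cos_abs]
  · intro hab
    rcases Real.Angle.cos_eq_iff_eq_or_eq_neg.1 hab with rfl | rfl
    · rfl
    · exact norm_neg b

theorem isPathConnected_setOf_cos_pos : IsPathConnected {φ : Real.Angle | 0 < φ.cos} := by
  have h : {φ : Real.Angle | 0 < φ.cos} =
      (fun t : ℝ => (t : Real.Angle)) '' Set.Ioo (-(Real.pi / 2)) (Real.pi / 2) := by
    ext φ
    constructor
    · intro hφ
      exact ⟨φ.toReal, abs_lt.1 (Real.Angle.cos_pos_iff_abs_toReal_lt_pi_div_two.1 hφ),
        φ.coe_toReal⟩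
    · rintro ⟨t, ht, rfl⟩
      exact Real.cos_pos_of_mem_Ioo ht
  rw [h]
  exact ((convex_Ioo _ _).isPathConnected
    ⟨0, by constructor <;> linarith [Real.pi_pos]⟩).image Real.Angle.continuous_coe

theorem isPathConnected_univ_angle : IsPathConnected (Set.univ : Set Real.Angle) := by
  have h : (fun t : ℝ => (t : Real.Angle)) '' Set.univ = Set.univ :=
    Set.eq_univ_of_forall fun φ => ⟨φ.toReal, trivial, φ.coe_toReal⟩
  rw [← h]
  exact (convex_univ.isPathConnected ⟨0, trivial⟩).image Real.Angle.continuous_coe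

/-- Compactness of the circle makes the projection to the plane a closed map, which
`isConnected_zeroSetB` uses. -/
instance : CompactSpace Real.Angle := by
  have : Fact (0 < 2 * Real.pi) := ⟨Real.two_pi_pos⟩
  exact inferInstanceAs (CompactSpace (AddCircle (2 * Real.pi)))

theorem exists_eq_two_arctan {θ : Real.Angle} (h : θ ≠ (Real.pi : Real.Angle)) :
    ∃ v : ℝ, θ = ((2 * Real.arctan v : ℝ) : Real.Angle) := by
  refine ⟨Real.tan (θ.toReal / 2), ?_⟩
  have h1 := θ.neg_pi_lt_toReal
  have h2 : θ.toReal < Real.pi := lt_of_le_of_ne θ.toReal_le_pi fun h0 => h <| by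
    rw [← θ.coe_toReal, h0]
  rw [Real.arctan_tan (by linarith) (by linarith), mul_div_cancel₀ _ two_ne_zero, θ.coe_toReal]

/-! ### The direction of the quadratic form -/

/-- The vector in the plane whose scalar product with the point at angle `θ₂` is `B̃`. -/
def gradient (q : ℝ × ℝ) : ℂ := ⟨constCoeff q, linCoeff q / 2⟩

/-- The angle where `B̃` is maximal over `q`. -/
def direction (q : ℝ × ℝ) : Real.Angle := ((gradient q).arg : Real.Angle)

/-- The angle where the multiple of `B̃` by the sign `ε` is maximal over `q`. -/
def midpoint (ε : ℤˣ) (q : ℝ × ℝ) : Real.Angle :=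
  direction q + if ε = 1 then 0 else (Real.pi : Real.Angle)

theorem continuous_constCoeff : Continuous constCoeff := by
  unfold constCoeff
  fun_prop

theorem continuous_linCoeff : Continuous linCoeff := by
  unfold linCoeff
  fun_prop

theorem continuous_gradient : Continuous gradient := by
  have h : gradient = fun q => (constCoeff q : ℂ) + ((linCoeff q / 2 : ℝ) : ℂ) * Complex.I :=
    funext fun q => Complex.mk_eq_add_mul_I _ _
  rw [h]
  exact (Complex.continuous_ofReal.comp continuous_constCoeff).add
    ((Complex.continuous_ofReal.comp (continuous_linCoeff.div_const 2)).mul continuous_const)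

theorem continuous_BP : Continuous fun x : Real.Angle × (ℝ × ℝ) => BP x.1 x.2 := by
  simp only [BP_eq]
  have h0 := continuous_constCoeff
  have h1 := continuous_linCoeff
  have h2 := Real.Angle.continuous_cos
  have h3 := Real.Angle.continuous_sin
  fun_prop

theorem gradient_eq_zero_iff (q : ℝ × ℝ) : gradient q = 0 ↔ q = pole (-1) ∨ q = pole 1 := by
  rw [← coeffs_eq_zero_iff, gradient, Complex.ext_iff]
  simp only [Complex.zero_re, Complex.zero_im]
  constructor
  · rintro ⟨h0, h1⟩
    have h2 : linCoeff q = 0 := by linarith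
    rw [h0, h2]
    ring
  · intro h
    have h1 : linCoeff q = 0 := by nlinarith [sq_nonneg (linCoeff q), sq_nonneg (constCoeff q)]
    rw [h1] at h
    exact ⟨by simpa using h, by rw [h1, zero_div]⟩

/-- Polar coordinates of the gradient. Zeros, signs and midpoints in a fiber are all read off from
this formula. -/
theorem BP_eq_norm_mul_cos (θ : Real.Angle) (q : ℝ × ℝ) :
    BP θ q = ‖gradient q‖ * (θ - direction q).cos := by
  have h1 : ‖gradient q‖ * Real.cos (gradient q).arg = constCoeff q :=
    Complex.norm_mul_cos_arg _
  have h2 : ‖gradient q‖ * Real.sin (gradient q).arg = linCoeff q / 2 :=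
    Complex.norm_mul_sin_arg _
  rw [BP_eq, direction, sub_eq_add_neg, Real.Angle.cos_add, Real.Angle.cos_neg,
    Real.Angle.sin_neg, Real.Angle.cos_coe, Real.Angle.sin_coe, ← h1, ← h2]
  ring

theorem sign_mul_BP (ε : ℤˣ) (θ : Real.Angle) (q : ℝ × ℝ) :
    ((ε : ℤ) : ℝ) * BP θ q = ‖gradient q‖ * (θ - midpoint ε q).cos := by
  rw [BP_eq_norm_mul_cos, midpoint]
  rcases Int.units_eq_one_or ε with rfl | rfl
  · simp
  · rw [if_neg (by decide), ← sub_sub, Real.Angle.cos_sub_pi]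
    simp

theorem sign_mul_BP_pos_iff (ε : ℤˣ) (θ : Real.Angle) (q : ℝ × ℝ) :
    0 < ((ε : ℤ) : ℝ) * BP θ q ↔ gradient q ≠ 0 ∧ 0 < (θ - midpoint ε q).cos := by
  rw [sign_mul_BP]
  by_cases h : gradient q = 0
  · simp [h]
  · simp [h]

/-- The argument jumps along the negative real axis, but only by `2π`, so as an angle it is
continuous away from `0`. -/
theorem continuousAt_direction {q : ℝ × ℝ} (h : gradient q ≠ 0) : ContinuousAt direction q :=
  (Complex.continuousAt_arg_coe_angle h).comp continuous_gradient.continuousAt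

theorem continuousAt_midpoint (ε : ℤˣ) {q : ℝ × ℝ} (h : gradient q ≠ 0) :
    ContinuousAt (midpoint ε) q :=
  (continuousAt_direction h).add continuousAt_const

/-- The angles of the two zeros of `B̃` over `q`. -/
def sheet (ε : ℤˣ) (q : ℝ × ℝ) : Real.Angle :=
  direction q + (((ε : ℤ) * (Real.pi / 2) : ℝ) : Real.Angle)

theorem continuousAt_sheet (ε : ℤˣ) {q : ℝ × ℝ} (h : gradient q ≠ 0) :
    ContinuousAt (sheet ε) q :=
  (continuousAt_direction h).add continuousAt_const

theorem sheet_ne (q : ℝ × ℝ) : sheet 1 q ≠ sheet (-1) q := by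
  intro h
  have h1 := congrArg Real.Angle.sin (add_left_cancel h)
  rw [Real.Angle.sin_coe, Real.Angle.sin_coe] at h1
  norm_num at h1

theorem BP_eq_zero_iff {q : ℝ × ℝ} (h : gradient q ≠ 0) (θ : Real.Angle) :
    BP θ q = 0 ↔ θ = sheet 1 q ∨ θ = sheet (-1) q := by
  rw [BP_eq_norm_mul_cos, mul_eq_zero, or_iff_right (norm_ne_zero_iff.2 h),
    Real.Angle.cos_eq_zero_iff, sub_eq_iff_eq_add', sub_eq_iff_eq_add', sheet, sheet]
  simp [neg_div]

/-- For `φ = θ - direction q`, equal distance to the zeros at `±π/2` means `sin φ = -sin φ`, so `φ`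
is `0` or `π`. -/
theorem isMidpoint_iff {q : ℝ × ℝ} (h : gradient q ≠ 0) (θ : Real.Angle) :
    IsMidpoint q θ ↔ ∃ ε, θ = midpoint ε q := by
  have hs : {φ | BP φ q = 0} = {sheet 1 q, sheet (-1) q} := Set.ext (BP_eq_zero_iff h)
  have e1 : dist θ (sheet 1 q) = dist θ (sheet (-1) q) ↔ (θ - direction q).sin = 0 := by
    rw [dist_eq_norm, dist_eq_norm, norm_angle_eq_norm_iff, sheet, sheet, ← sub_sub, ← sub_sub]
    have h2 : (((((-1 : ℤˣ) : ℤ) : ℝ) * (Real.pi / 2) : ℝ) : Real.Angle) =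
        -((Real.pi / 2 : ℝ) : Real.Angle) := by simp
    rw [h2, sub_neg_eq_add, Real.Angle.cos_add_pi_div_two]
    simp only [Units.val_one, Int.cast_one, one_mul]
    rw [Real.Angle.cos_sub_pi_div_two]
    constructor <;> intro h <;> linarith
  have e2 : (∃ ε, θ = midpoint ε q) ↔ (θ - direction q).sin = 0 := by
    rw [Real.Angle.sin_eq_zero_iff, sub_eq_iff_eq_add', sub_eq_iff_eq_add']
    constructor
    · rintro ⟨ε, rfl⟩
      rw [midpoint]
      split_ifs <;> simp
    · rintro (h | h)
      · exact ⟨1, by rw [h, midpoint, if_pos rfl]⟩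
      · exact ⟨-1, by rw [h, midpoint, if_neg (by decide)]⟩
  rw [e2, ← e1, IsMidpoint, hs]
  constructor
  · rintro ⟨z, w, -, hzw, hd⟩
    rcases Set.pair_eq_pair_iff.1 hzw with ⟨h1, h2⟩ | ⟨h1, h2⟩
    · rw [h1, h2, hd]
    · rw [h1, h2, hd]
  · intro hd
    exact ⟨_, _, sheet_ne q, rfl, hd⟩

/-! ### Components given by signs -/

/-- Each piece is open and so is the union of the others, so a connected subset of `S` that meets a
piece stays inside it. -/
theorem connectedComponentIn_eq_of_partition {E D : Type*} [TopologicalSpace E] {S : Set E}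
    {P : D → Set E} (hS : S = ⋃ d, P d) (hopen : ∀ d, IsOpen (P d))
    (hdisj : ∀ d e, d ≠ e → Disjoint (P d) (P e)) (hconn : ∀ d, IsPreconnected (P d))
    {d : D} {x : E} (hx : x ∈ P d) : connectedComponentIn S x = P d := by
  have hsub : P d ⊆ S := hS ▸ Set.subset_iUnion P d
  refine Set.Subset.antisymm ?_ ((hconn d).subset_connectedComponentIn hx hsub)
  refine isPreconnected_connectedComponentIn.subset_left_of_subset_union (hopen d)
    (v := ⋃ e, ⋃ (_ : e ≠ d), P e) (isOpen_iUnion fun e => isOpen_iUnion fun _ => hopen e)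
    ?_ ?_ ⟨x, mem_connectedComponentIn (hsub hx), hx⟩
  · simp only [Set.disjoint_iUnion_right]
    exact fun e he => hdisj d e he.symm
  · refine (connectedComponentIn_subset S x).trans fun y hy => ?_
    rw [hS] at hy
    obtain ⟨e, he⟩ := Set.mem_iUnion.1 hy
    by_cases h : e = d
    · exact Or.inl (h ▸ he)
    · exact Or.inr (Set.mem_iUnion₂.2 ⟨e, h, he⟩)

theorem card_connectedComponents_of_partition {E D : Type*} [TopologicalSpace E] {S : Set E}
    {P : D → Set E} (hS : S = ⋃ d, P d) (hopen : ∀ d, IsOpen (P d))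
    (hdisj : ∀ d e, d ≠ e → Disjoint (P d) (P e)) (hconn : ∀ d, IsConnected (P d)) :
    Nat.card (ConnectedComponents ↥S) = Nat.card D := by
  choose x hx using fun d => (hconn d).nonempty
  have hsub (d) : P d ⊆ S := hS ▸ Set.subset_iUnion P d
  have hcomp {d : D} {x : E} (h : x ∈ P d) : connectedComponentIn S x = P d :=
    connectedComponentIn_eq_of_partition hS hopen hdisj (fun d => (hconn d).isPreconnected) h
  have key (a b : ↥S) : (a : ConnectedComponents ↥S) = b ↔
      connectedComponentIn S a = connectedComponentIn S b := by
    rw [ConnectedComponents.coe_eq_coe, connectedComponentIn_eq_image a.2,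
      connectedComponentIn_eq_image b.2, Set.image_eq_image Subtype.val_injective]
  refine (Nat.card_eq_of_bijective
    (fun d => ((⟨x d, hsub d (hx d)⟩ : ↥S) : ConnectedComponents ↥S)) ⟨fun d e h => ?_, ?_⟩).symm
  · have h1 := (key _ _).1 h
    rw [hcomp (hx d), hcomp (hx e)] at h1
    by_contra hne
    exact Set.disjoint_left.1 (hdisj d e hne) (hx d) (h1 ▸ hx d)
  · intro c
    obtain ⟨a, rfl⟩ := ConnectedComponents.surjective_coe c
    obtain ⟨d, hd⟩ := Set.mem_iUnion.1 (hS ▸ a.2 : (a : E) ∈ ⋃ d, P d)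
    exact ⟨d, (key _ _).2 (by rw [hcomp (hx d), hcomp hd])⟩

theorem exists_sign_mul_pos_iff (a : ℝ) : (∃ ε : ℤˣ, 0 < ((ε : ℤ) : ℝ) * a) ↔ a ≠ 0 := by
  constructor
  · rintro ⟨ε, h⟩ rfl
    simp at h
  · intro h
    rcases lt_or_gt_of_ne h with h | h
    · exact ⟨-1, by simpa⟩
    · exact ⟨1, by simpa⟩

theorem sign_eq_of_mul_pos {ε η : ℤˣ} {a : ℝ} (h₁ : 0 < ((ε : ℤ) : ℝ) * a)
    (h₂ : 0 < ((η : ℤ) : ℝ) * a) : ε = η := by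
  rcases Int.units_eq_one_or ε with rfl | rfl <;> rcases Int.units_eq_one_or η with rfl | rfl <;>
    simp at * <;> linarith

theorem sign_mul_pos_iff {ε : ℤˣ} {a : ℝ} (h : 0 < ((ε : ℤ) : ℝ) * a) (b : ℝ) :
    0 < ((ε : ℤ) : ℝ) * b ↔ 0 < a * b := by
  rcases Int.units_eq_one_or ε with rfl | rfl
  · simp only [Units.val_one, Int.cast_one, one_mul] at *
    exact (mul_pos_iff_of_pos_left h).symm
  · simp only [Units.val_neg, Units.val_one, Int.cast_neg, Int.cast_one, neg_mul, one_mul] at *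
    rw [← mul_pos_iff_of_pos_left h, neg_mul_neg]

theorem continuous_sign_mul (ε : ℤˣ) : Continuous fun a : ℝ => ((ε : ℤ) : ℝ) * a :=
  continuous_const.mul continuous_id

/-! ### The half-planes without the poles -/

/-- A component of `Y`: the part where `v₃` has the sign `η`. -/
def halfY (η : ℤˣ) : Set (ℝ × ℝ) := {q | 0 < ((η : ℤ) : ℝ) * q.1 ∧ q ≠ pole η}

theorem mem_halfY_iff {η : ℤˣ} {q : ℝ × ℝ} :
    q ∈ halfY η ↔ q ∈ baseY (pole (-1)) (pole 1) ∧ 0 < ((η : ℤ) : ℝ) * q.1 := by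
  have h1 := pole_fst_pos 1
  have h2 := pole_fst_pos (-1)
  simp only [halfY, baseY, Set.mem_ofPred_eq, Set.mem_compl_iff, Set.mem_union, Set.mem_insert_iff,
    Set.mem_singleton_iff, not_or]
  rcases Int.units_eq_one_or η with rfl | rfl
  · simp only [Units.val_one, Int.cast_one, one_mul, Units.val_neg, Int.cast_neg, neg_mul] at *
    refine ⟨fun ⟨h, h'⟩ => ⟨⟨⟨?_, h'⟩, h.ne'⟩, h⟩, fun ⟨⟨⟨_, h'⟩, _⟩, h⟩ => ⟨h, h'⟩⟩
    rintro rfl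
    linarith
  · simp only [Units.val_one, Int.cast_one, one_mul, Units.val_neg, Int.cast_neg, neg_mul] at *
    refine ⟨fun ⟨h, h'⟩ => ⟨⟨⟨h', ?_⟩, (neg_pos.1 h).ne⟩, h⟩, fun ⟨⟨⟨h', _⟩, _⟩, h⟩ => ⟨h, h'⟩⟩
    rintro rfl
    linarith

theorem baseY_eq_iUnion : baseY (pole (-1)) (pole 1) = ⋃ η, halfY η := by
  ext q
  simp only [Set.mem_iUnion, mem_halfY_iff, exists_and_left, exists_sign_mul_pos_iff]
  refine (and_iff_left_of_imp fun h h0 => h (Or.inr h0)).symm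

theorem gradient_ne_zero {q : ℝ × ℝ} (h : q ∈ baseY (pole (-1)) (pole 1)) : gradient q ≠ 0 :=
  fun h0 => h (Or.inl ((gradient_eq_zero_iff q).1 h0))

theorem isOpen_halfY (η : ℤˣ) : IsOpen (halfY η) :=
  (isOpen_lt continuous_const ((continuous_sign_mul η).comp continuous_fst)).inter
    isOpen_compl_singleton

theorem isOpen_baseY (q₁ q₂ : ℝ × ℝ) : IsOpen (baseY q₁ q₂) :=
  (((Set.toFinite {q₁, q₂}).isClosed).union
    (isClosed_eq continuous_fst continuous_const)).isOpen_compl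

/-- Any two points of a half-plane are joined by two segments that avoid a given point. -/
theorem exists_two_segments (δ : ℝ) {p x y : ℝ × ℝ} (hxp : x ≠ p) (hyp : y ≠ p)
    (hx : 0 < δ * x.1) (hy : 0 < δ * y.1) :
    ∃ r : ℝ × ℝ, 0 < δ * r.1 ∧ p ∉ segment ℝ x r ∧ p ∉ segment ℝ r y := by
  by_cases hp : p ∈ segment ℝ x y
  -- The scalar product with a normal of the line through `x` and `y`, based at `p`, vanishes at `z`
  -- and not at `r`. Hence the segment from `z` to `r` meets that line only in `z`, which is not
  -- `p`.
  · have avoid (r z : ℝ × ℝ) (hz : (z.1 - p.1) * -(y.2 - x.2) + (z.2 - p.2) * (y.1 - x.1) = 0)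
        (hr : (r.1 - p.1) * -(y.2 - x.2) + (r.2 - p.2) * (y.1 - x.1) ≠ 0) (hzp : z ≠ p) :
        p ∉ segment ℝ z r := by
      rintro ⟨a, b, ha, hb, hab, h⟩
      have h1 : a * z.1 + b * r.1 = p.1 := congrArg Prod.fst h
      have h2 : a * z.2 + b * r.2 = p.2 := congrArg Prod.snd h
      have hb0 : b = 0 := by
        refine (mul_eq_zero.1 (?_ : b * _ = 0)).resolve_right hr
        have : a = 1 - b := by linarith
        subst this
        linear_combination (1 - b) * (-hz) + (-(y.2 - x.2)) * h1 + (y.1 - x.1) * h2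
      rw [hb0, add_zero] at hab
      rw [hb0, hab] at h
      exact hzp (by simpa using h)
    obtain ⟨a, b, ha, hb, hab, h⟩ := hp
    have h1 : a * x.1 + b * y.1 = p.1 := congrArg Prod.fst h
    have h2 : a * x.2 + b * y.2 = p.2 := congrArg Prod.snd h
    obtain rfl : a = 1 - b := by linarith
    have hxy : 0 < (y.2 - x.2) ^ 2 + (y.1 - x.1) ^ 2 := by
      by_contra! h0
      have e2 : y.2 = x.2 := by nlinarith [sq_nonneg (y.2 - x.2), sq_nonneg (y.1 - x.1)]
      have e1 : y.1 = x.1 := by nlinarith [sq_nonneg (y.2 - x.2), sq_nonneg (y.1 - x.1)]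
      refine hxp (Prod.ext ?_ ?_)
      · rw [← h1, e1]; ring
      · rw [← h2, e2]; ring
    have hp1 : 0 < δ * p.1 := by
      rw [← h1]
      have : δ * ((1 - b) * x.1 + b * y.1) = (1 - b) * (δ * x.1) + b * (δ * y.1) := by ring
      rw [this]
      rcases hb.eq_or_lt with rfl | hb'
      · simpa
      · have := mul_nonneg ha hx.le
        have := mul_pos hb' hy
        linarith
    -- The detour leaves `p` along the normal; the sign of `k` is chosen so that it does not
    -- approach the boundary of the half-plane.
    obtain ⟨k, hk0, hk⟩ : ∃ k : ℝ, k ≠ 0 ∧ 0 ≤ k * (δ * -(y.2 - x.2)) := by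
      rcases le_total 0 (δ * -(y.2 - x.2)) with h | h
      · exact ⟨1, one_ne_zero, by linarith⟩
      · exact ⟨-1, by norm_num, by linarith⟩
    have hr : ((p.1 + k * -(y.2 - x.2)) - p.1) * -(y.2 - x.2) +
        ((p.2 + k * (y.1 - x.1)) - p.2) * (y.1 - x.1) ≠ 0 := by
      have : ((p.1 + k * -(y.2 - x.2)) - p.1) * -(y.2 - x.2) +
        ((p.2 + k * (y.1 - x.1)) - p.2) * (y.1 - x.1) =
          k * ((y.2 - x.2) ^ 2 + (y.1 - x.1) ^ 2) := by ring
      rw [this]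
      exact mul_ne_zero hk0 hxy.ne'
    refine ⟨(p.1 + k * -(y.2 - x.2), p.2 + k * (y.1 - x.1)), ?_, ?_, ?_⟩
    · have : δ * (p.1 + k * -(y.2 - x.2)) = δ * p.1 + k * (δ * -(y.2 - x.2)) := by ring
      rw [this]
      linarith
    · exact avoid _ x (by rw [← h1, ← h2]; ring) hr hxp
    · rw [segment_symm]
      exact avoid _ y (by rw [← h1, ← h2]; ring) hr hyp
  · refine ⟨y, hy, hp, ?_⟩
    rw [segment_same]
    exact fun h => hyp h.symm

theorem segment_subset_halfY {η : ℤˣ} {x y : ℝ × ℝ} (hx : 0 < ((η : ℤ) : ℝ) * x.1)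
    (hy : 0 < ((η : ℤ) : ℝ) * y.1) (hp : pole η ∉ segment ℝ x y) : segment ℝ x y ⊆ halfY η := by
  refine fun z hz => ⟨?_, fun h => hp (h ▸ hz)⟩
  have hc : Convex ℝ {q : ℝ × ℝ | 0 < ((η : ℤ) : ℝ) * q.1} :=
    convex_halfSpace_gt (f := fun q : ℝ × ℝ => ((η : ℤ) : ℝ) * q.1)
      ⟨fun a b => by simp [mul_add], fun c a => by simp [mul_left_comm]⟩ 0
  exact hc.segment_subset hx hy hz

theorem exists_segments_subset_halfY {η : ℤˣ} {x y : ℝ × ℝ} (hx : x ∈ halfY η)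
    (hy : y ∈ halfY η) : ∃ r, segment ℝ x r ⊆ halfY η ∧ segment ℝ r y ⊆ halfY η := by
  obtain ⟨r, hr, h1, h2⟩ := exists_two_segments _ hx.2 hy.2 hx.1 hy.1
  exact ⟨r, segment_subset_halfY hx.1 hr h1, segment_subset_halfY hr hy.1 h2⟩

theorem isPathConnected_halfY (η : ℤˣ) : IsPathConnected (halfY η) := by
  have h := pole_fst_pos η
  refine ⟨((pole η).1, (pole η).2 + 1), ⟨h, fun h0 => ?_⟩, fun {y} hy => ?_⟩
  · have := congrArg Prod.snd h0
    simp at this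
  · obtain ⟨r, h1, h2⟩ := exists_segments_subset_halfY (η := η)
      (x := ((pole η).1, (pole η).2 + 1)) (y := y) ⟨h, fun h0 => by
        have := congrArg Prod.snd h0
        simp at this⟩ hy
    exact (JoinedIn.of_segment_subset h1).trans (JoinedIn.of_segment_subset h2)

theorem disjoint_halfY (η κ : ℤˣ) (h : η ≠ κ) : Disjoint (halfY η) (halfY κ) :=
  Set.disjoint_left.2 fun _ h₁ h₂ => h (sign_eq_of_mul_pos h₁.1 h₂.1)

theorem card_components_baseY :
    Nat.card (ConnectedComponents ↥(baseY (pole (-1)) (pole 1))) = 2 := by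
  rw [card_connectedComponents_of_partition baseY_eq_iUnion isOpen_halfY disjoint_halfY
    fun η => (isPathConnected_halfY η).isConnected]
  simp [Nat.card_eq_fintype_card]

/-! ### The complement of the zero set over `Y` -/

/-- The part over a component of `Y` where `B̃` has the sign `ε`. -/
def signedPiece (d : ℤˣ × ℤˣ) : Set (Real.Angle × (ℝ × ℝ)) :=
  {x | 0 < ((d.1 : ℤ) : ℝ) * BP x.1 x.2 ∧ 0 < ((d.2 : ℤ) : ℝ) * x.2.1}

/-- Over a pole `B̃` vanishes identically, so a point with a strict sign of `B̃` does not lie over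
one. -/
theorem snd_mem_halfY {d : ℤˣ × ℤˣ} {x : Real.Angle × (ℝ × ℝ)} (h : x ∈ signedPiece d) :
    x.2 ∈ halfY d.2 := by
  refine ⟨h.2, fun h0 => ?_⟩
  refine ((sign_mul_BP_pos_iff _ _ _).1 h.1).1 ((gradient_eq_zero_iff _).2 ?_)
  rw [h0]
  rcases Int.units_eq_one_or d.2 with h1 | h1 <;> simp [h1]

theorem mem_baseY_of_mem_halfY {η : ℤˣ} {q : ℝ × ℝ} (h : q ∈ halfY η) :
    q ∈ baseY (pole (-1)) (pole 1) := (mem_halfY_iff.1 h).1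

theorem gradient_ne_zero_of_mem_halfY {η : ℤˣ} {q : ℝ × ℝ} (h : q ∈ halfY η) : gradient q ≠ 0 :=
  gradient_ne_zero (mem_baseY_of_mem_halfY h)

/-- Rotating each fiber by its midpoint trivializes the piece: it becomes the half circle `cos > 0`
times a punctured half-plane. -/
theorem isPathConnected_signedPiece (d : ℤˣ × ℤˣ) : IsPathConnected (signedPiece d) := by
  have h : signedPiece d = (fun z : Real.Angle × (ℝ × ℝ) => (midpoint d.1 z.2 + z.1, z.2)) ''
      ({φ : Real.Angle | 0 < φ.cos} ×ˢ halfY d.2) := by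
    ext x
    constructor
    · intro hx
      have h2 := snd_mem_halfY hx
      refine ⟨(x.1 - midpoint d.1 x.2, x.2), ⟨((sign_mul_BP_pos_iff _ _ _).1 hx.1).2, h2⟩, ?_⟩
      simp
    · rintro ⟨z, ⟨h1, h2⟩, rfl⟩
      refine ⟨(sign_mul_BP_pos_iff _ _ _).2 ⟨gradient_ne_zero_of_mem_halfY h2, ?_⟩, h2.1⟩
      simpa using h1
  rw [h]
  refine (isPathConnected_setOf_cos_pos.prod (isPathConnected_halfY d.2)).image' fun z hz => ?_
  refine ContinuousAt.continuousWithinAt (ContinuousAt.prodMk (ContinuousAt.add ?_ continuousAt_fst)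
    continuousAt_snd)
  exact (continuousAt_midpoint d.1 (gradient_ne_zero_of_mem_halfY hz.2)).comp
    (f := Prod.snd) continuousAt_snd

theorem isOpen_signedPiece (d : ℤˣ × ℤˣ) : IsOpen (signedPiece d) :=
  (isOpen_lt continuous_const ((continuous_sign_mul d.1).comp continuous_BP)).inter
    (isOpen_lt continuous_const ((continuous_sign_mul d.2).comp
      (continuous_fst.comp continuous_snd)))

theorem card_components_compl_zeroSetB :
    Nat.card (ConnectedComponents ↥{x : Real.Angle × (ℝ × ℝ) | x ∉ zeroSetB ∧
      x.2 ∈ baseY (pole (-1)) (pole 1)}) = 4 := by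
  rw [card_connectedComponents_of_partition (P := signedPiece) ?_ isOpen_signedPiece ?_
    fun d => (isPathConnected_signedPiece d).isConnected]
  · simp [Nat.card_eq_fintype_card]
  · ext x
    rw [Set.mem_iUnion]
    constructor
    · rintro ⟨h1, h2⟩
      obtain ⟨ε, hε⟩ := (exists_sign_mul_pos_iff (BP x.1 x.2)).2 h1
      obtain ⟨η, hη⟩ := (exists_sign_mul_pos_iff x.2.1).2 fun h0 => h2 (Or.inr h0)
      exact ⟨(ε, η), hε, hη⟩
    · rintro ⟨d, hd⟩
      exact ⟨(exists_sign_mul_pos_iff _).1 ⟨_, hd.1⟩, mem_baseY_of_mem_halfY (snd_mem_halfY hd)⟩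
  · exact fun d e hde => Set.disjoint_left.2 fun x h1 h2 =>
      hde (Prod.ext (sign_eq_of_mul_pos h1.1 h2.1) (sign_eq_of_mul_pos h1.2 h2.2))

theorem isConnected_setOf_sign_mul_BP_pos (ε : ℤˣ) {q : ℝ × ℝ} (h : gradient q ≠ 0) :
    IsConnected {θ | 0 < ((ε : ℤ) : ℝ) * BP θ q} := by
  have e : {θ | 0 < ((ε : ℤ) : ℝ) * BP θ q} =
      (fun φ => midpoint ε q + φ) '' {φ : Real.Angle | 0 < φ.cos} := by
    ext θ
    rw [Set.mem_ofPred_eq, sign_mul_BP_pos_iff, and_iff_right h]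
    constructor
    · exact fun hθ => ⟨θ - midpoint ε q, hθ, by simp⟩
    · rintro ⟨φ, hφ, rfl⟩
      simpa using hφ
  rw [e]
  exact (isPathConnected_setOf_cos_pos.image (continuous_const.add continuous_id)).isConnected

/-! ### The zero set -/

/-- Each sheet is a graph over the plane without the two poles, which is connected. Over a pole the
whole circle lies in the zero set, and it touches the closure of both sheets, so the circles glue
the sheets together. -/
theorem isConnected_zeroSetB : IsConnected zeroSetB := by
  have hU : IsConnected ({pole (-1), pole 1}ᶜ : Set (ℝ × ℝ)) := by
    refine (Set.toFinite _).countable.isConnected_compl_of_one_lt_rank ?_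
    rw [rank_prod', Module.rank_self]
    norm_num
  have hg {q : ℝ × ℝ} (hq : q ∈ ({pole (-1), pole 1}ᶜ : Set (ℝ × ℝ))) : gradient q ≠ 0 :=
    fun h => hq ((gradient_eq_zero_iff q).1 h)
  set G : ℤˣ → Set (Real.Angle × (ℝ × ℝ)) :=
    fun ε => (fun q => (sheet ε q, q)) '' ({pole (-1), pole 1}ᶜ) with hG
  have hGc (ε) : IsConnected (G ε) :=
    hU.image _ fun q hq =>
      ((continuousAt_sheet ε (hg hq)).prodMk continuousAt_id).continuousWithinAt
  have hdense : Dense ({pole (-1), pole 1}ᶜ : Set (ℝ × ℝ)) := by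
    refine Set.Countable.dense_compl ℝ (Set.toFinite _).countable
  -- The projection of the closure of a sheet is closed and contains a dense set, hence also the
  -- poles.
  have hcl (ε η) : ∃ θ, (θ, pole η) ∈ closure (G ε) := by
    have h1 : IsClosed (Prod.snd '' closure (G ε)) :=
      isClosedMap_snd_of_compactSpace _ isClosed_closure
    have h2 : ({pole (-1), pole 1}ᶜ : Set (ℝ × ℝ)) ⊆ Prod.snd '' closure (G ε) := fun q hq =>
      ⟨(sheet ε q, q), subset_closure ⟨q, hq, rfl⟩, rfl⟩
    have h3 : pole η ∈ Prod.snd '' closure (G ε) :=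
      h1.closure_subset_iff.2 h2 (hdense _)
    obtain ⟨⟨θ, q⟩, hθ, rfl⟩ := h3
    exact ⟨θ, hθ⟩
  set K : ℤˣ → Set (Real.Angle × (ℝ × ℝ)) := fun η => Set.univ ×ˢ {pole η} with hK
  have hKc (η) : IsConnected (K η) :=
    isPathConnected_univ_angle.isConnected.prod isConnected_singleton
  have hGK (ε η) : IsConnected (G ε ∪ K η) := by
    obtain ⟨θ, hθ⟩ := hcl ε η
    have h1 : IsConnected (insert (θ, pole η) (G ε)) :=
      (hGc ε).subset_closure (Set.subset_insert _ _)
        (Set.insert_subset hθ subset_closure)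
    have hne : (insert (θ, pole η) (G ε) ∩ K η).Nonempty :=
      ⟨(θ, pole η), Set.mem_insert _ _, trivial, rfl⟩
    have h2 := IsConnected.union hne h1 (hKc η)
    have h3 : insert (θ, pole η) (G ε) ∪ K η = G ε ∪ K η := by
      rw [Set.insert_union, Set.insert_eq_of_mem]
      exact Or.inr ⟨trivial, rfl⟩
    rwa [h3] at h2
  have hZ : zeroSetB = ((G 1 ∪ K 1) ∪ (G (-1) ∪ K 1)) ∪ (G 1 ∪ K (-1)) := by
    ext ⟨θ, q⟩
    by_cases hq : q ∈ ({pole (-1), pole 1}ᶜ : Set (ℝ × ℝ))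
    · have h1 : q ≠ pole 1 := fun h => hq (Or.inr h)
      have h2 : q ≠ pole (-1) := fun h => hq (Or.inl h)
      have h3 (ε) : (θ, q) ∈ G ε ↔ θ = sheet ε q := by
        constructor
        · rintro ⟨p, -, h⟩
          obtain ⟨rfl, rfl⟩ := Prod.ext_iff.1 h
          rfl
        · rintro rfl
          exact ⟨q, hq, rfl⟩
      simp only [zeroSetB, Set.mem_ofPred_eq, BP_eq_zero_iff (hg hq), Set.mem_union, h3, hK,
        Set.mem_prod, Set.mem_singleton_iff, h1, h2, and_false, or_false]
      tauto
    · have h0 : gradient q = 0 := by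
        rw [gradient_eq_zero_iff]
        exact not_not.1 hq
      have h1 : (θ, q) ∈ zeroSetB := by
        rw [zeroSetB, Set.mem_ofPred_eq, BP_eq_norm_mul_cos, h0, norm_zero, zero_mul]
      simp only [h1, true_iff]
      rcases (gradient_eq_zero_iff q).1 h0 with rfl | rfl
      · exact Or.inr (Or.inr ⟨trivial, rfl⟩)
      · exact Or.inl (Or.inl (Or.inr ⟨trivial, rfl⟩))
  rw [hZ]
  refine IsConnected.union ?_ (IsConnected.union ?_ (hGK 1 1) (hGK (-1) 1)) (hGK 1 (-1))
  · obtain ⟨z, hz⟩ := (hGc 1).nonempty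
    exact ⟨z, Or.inl (Or.inl hz), Or.inl hz⟩
  · exact ⟨(0, pole 1), Or.inr ⟨trivial, rfl⟩, Or.inr ⟨trivial, rfl⟩⟩

/-- A set that consists of two disjoint graphs over an open set covers it. -/
theorem isCoveringMapOn_of_two_sections {A X : Type*} [TopologicalSpace A] [T2Space A]
    [TopologicalSpace X] {Z : Set (A × X)} {Y : Set X} (hY : IsOpen Y) (s : Bool → X → A)
    (hs : ∀ b, ContinuousOn (s b) Y) (hne : ∀ q ∈ Y, s true q ≠ s false q)
    (hZ : ∀ q ∈ Y, ∀ a, (a, q) ∈ Z ↔ ∃ b, a = s b q) :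
    IsCoveringMapOn (fun x : ↥Z => (x : A × X).2) Y := by
  classical
  have hpre : IsOpen ((fun x : ↥Z => (x : A × X).2) ⁻¹' Y) :=
    hY.preimage (continuous_snd.comp continuous_subtype_val)
  set E := (fun x : ↥Z => (x : A × X).2) ⁻¹' Y with hE
  have hproj : Continuous fun z : ↥E => (⟨z.1.1.2, z.2⟩ : ↥Y) := by fun_prop
  have hfst : Continuous fun z : ↥E => z.1.1.1 := by fun_prop
  have hsc (b) : Continuous fun q : ↥Y => s b q := continuousOn_iff_continuous_domRestrict.1 (hs b)
  have hz (z : ↥E) : ∃ b, z.1.1.1 = s b z.1.1.2 := (hZ _ z.2 _).1 z.1.2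
  have hclosed (b) : IsClosed {z : ↥E | z.1.1.1 = s b z.1.1.2} :=
    isClosed_eq hfst ((hsc b).comp hproj)
  -- Over `Y` the two sheets are closed and complementary, hence also open. So the index of the
  -- sheet is a continuous function and gives the trivialization.
  have hcompl : {z : ↥E | z.1.1.1 = s true z.1.1.2}ᶜ = {z : ↥E | z.1.1.1 = s false z.1.1.2} := by
    ext z
    simp only [Set.mem_compl_iff, Set.mem_ofPred_eq]
    constructor
    · intro h
      obtain ⟨b, hb⟩ := hz z
      cases b
      · exact hb
      · exact absurd hb h
    · exact fun h h' => hne _ z.2 (h'.symm.trans h)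
  have hopen : IsOpen {z : ↥E | z.1.1.1 = s true z.1.1.2} :=
    isClosed_compl_iff.1 (hcompl ▸ hclosed false)
  let idx : ↥E → Bool := fun z => decide (z.1.1.1 = s true z.1.1.2)
  have hidx (z : ↥E) : s (idx z) z.1.1.2 = z.1.1.1 := by
    obtain ⟨b, hb⟩ := hz z
    by_cases h : z.1.1.1 = s true z.1.1.2
    · have : idx z = true := decide_eq_true h
      rw [this, h]
    · have : idx z = false := decide_eq_false h
      cases b
      · rw [this, hb]
      · exact absurd hb h
  have hidxc : Continuous idx := by
    rw [continuous_bool_rng true]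
    have h1 : idx ⁻¹' {true} = {z : ↥E | z.1.1.1 = s true z.1.1.2} := by
      ext z
      simp [idx]
    rw [h1]
    exact ⟨hclosed true, hopen⟩
  have hinv : Continuous fun w : ↥Y × Bool => s w.2 w.1 := by
    refine continuous_prod_of_discrete_right.2 fun b => ?_
    exact hsc b
  have hmem (w : ↥Y × Bool) : (s w.2 w.1, (w.1 : X)) ∈ Z := (hZ _ w.1.2 _).2 ⟨w.2, rfl⟩
  let inv : ↥Y × Bool → ↥E := fun w => ⟨⟨(s w.2 w.1, w.1), hmem w⟩, w.1.2⟩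
  have hinvc : Continuous inv :=
    ((hinv.prodMk (continuous_subtype_val.comp continuous_fst)).subtype_mk hmem).subtype_mk
      fun w => w.1.2
  have hidx_inv (w : ↥Y × Bool) : idx (inv w) = w.2 := by
    obtain ⟨q, b⟩ := w
    cases b
    · exact decide_eq_false fun h => hne _ q.2 h.symm
    · exact decide_eq_true rfl
  let H : ↥E ≃ₜ ↥Y × Bool :=
    { toFun := fun z => (⟨z.1.1.2, z.2⟩, idx z)
      invFun := inv
      left_inv := fun z => Subtype.ext (Subtype.ext (Prod.ext (hidx z) rfl))
      right_inv := fun w => Prod.ext rfl (hidx_inv w)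
      continuous_toFun := hproj.prodMk hidxc
      continuous_invFun := hinvc }
  exact fun q₀ hq₀ => IsEvenlyCovered.to_isEvenlyCovered_preimage (I := Bool)
    ⟨inferInstance, Y, hq₀, hY, hpre, H, fun _ => rfl⟩

theorem isCoveringMapOn_zeroSetB :
    IsCoveringMapOn (fun x : ↥zeroSetB => (x : Real.Angle × (ℝ × ℝ)).2)
      (baseY (pole (-1)) (pole 1)) := by
  refine isCoveringMapOn_of_two_sections (isOpen_baseY _ _) (fun b => sheet (if b then 1 else -1))
    (fun b q hq => (continuousAt_sheet _ (gradient_ne_zero hq)).continuousWithinAt)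
    (fun q _ => sheet_ne q) fun q hq θ => ?_
  rw [zeroSetB, Set.mem_ofPred_eq, BP_eq_zero_iff (gradient_ne_zero hq), Bool.exists_bool, or_comm]
  rfl

/-! ### The components in the half-angle parameters -/

/-- The component of the non-singular parameters given by the signs of `B̃`, `v₃` and `v₅`. -/
def reducedPiece (d : ℤˣ × ℤˣ × ℤˣ) : Set ReducedConfig :=
  {x | 0 < ((d.1 : ℤ) : ℝ) * BP x.1 x.2.1 ∧ 0 < ((d.2.1 : ℤ) : ℝ) * x.2.1.1 ∧
    0 < ((d.2.2 : ℤ) : ℝ) * x.2.2}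

theorem mem_nonsingularReduced_iff (x : ReducedConfig) :
    x ∈ nonsingularReduced ↔ BP x.1 x.2.1 ≠ 0 ∧ x.2.1.1 ≠ 0 ∧ x.2.2 ≠ 0 := by
  simp only [nonsingularReduced, AP, Set.mem_ofPred_eq, ne_eq, mul_eq_zero, not_or, and_assoc]

theorem nonsingularReduced_eq_iUnion : nonsingularReduced = ⋃ d, reducedPiece d := by
  ext x
  rw [mem_nonsingularReduced_iff, Set.mem_iUnion, ← exists_sign_mul_pos_iff,
    ← exists_sign_mul_pos_iff, ← exists_sign_mul_pos_iff]
  constructor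
  · rintro ⟨⟨ε, hε⟩, ⟨η, hη⟩, ⟨κ, hκ⟩⟩
    exact ⟨(ε, η, κ), hε, hη, hκ⟩
  · rintro ⟨d, h1, h2, h3⟩
    exact ⟨⟨_, h1⟩, ⟨_, h2⟩, ⟨_, h3⟩⟩

theorem continuous_BP_reduced : Continuous fun x : ReducedConfig => BP x.1 x.2.1 := by
  simp only [BP_eq]
  have h0 := continuous_constCoeff
  have h1 := continuous_linCoeff
  have h2 := Real.Angle.continuous_cos
  have h3 := Real.Angle.continuous_sin
  fun_prop

theorem isOpen_reducedPiece (d : ℤˣ × ℤˣ × ℤˣ) : IsOpen (reducedPiece d) :=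
  (isOpen_lt continuous_const ((continuous_sign_mul d.1).comp continuous_BP_reduced)).inter
    ((isOpen_lt continuous_const ((continuous_sign_mul d.2.1).comp
      (continuous_fst.comp (continuous_fst.comp continuous_snd)))).inter
    (isOpen_lt continuous_const ((continuous_sign_mul d.2.2).comp
      (continuous_snd.comp continuous_snd))))

theorem eq_of_mem_reducedPiece {d e : ℤˣ × ℤˣ × ℤˣ} {x : ReducedConfig}
    (h₁ : x ∈ reducedPiece d) (h₂ : x ∈ reducedPiece e) : d = e :=
  Prod.ext (sign_eq_of_mul_pos h₁.1 h₂.1)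
    (Prod.ext (sign_eq_of_mul_pos h₁.2.1 h₂.2.1) (sign_eq_of_mul_pos h₁.2.2 h₂.2.2))

theorem disjoint_reducedPiece (d e : ℤˣ × ℤˣ × ℤˣ) (h : d ≠ e) :
    Disjoint (reducedPiece d) (reducedPiece e) :=
  Set.disjoint_left.2 fun _ h₁ h₂ => h (eq_of_mem_reducedPiece h₁ h₂)

theorem isPathConnected_setOf_sign_mul_pos (κ : ℤˣ) :
    IsPathConnected {t : ℝ | 0 < ((κ : ℤ) : ℝ) * t} := by
  rcases Int.units_eq_one_or κ with rfl | rfl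
  · simpa [Set.Ioi] using (convex_Ioi (0 : ℝ)).isPathConnected ⟨1, Set.mem_Ioi.2 one_pos⟩
  · simpa [Set.Iio] using (convex_Iio (0 : ℝ)).isPathConnected ⟨-1, Set.mem_Iio.2 neg_one_lt_zero⟩

theorem isPathConnected_reducedPiece (d : ℤˣ × ℤˣ × ℤˣ) : IsPathConnected (reducedPiece d) := by
  have h : reducedPiece d =
      (fun z : (Real.Angle × (ℝ × ℝ)) × ℝ => ((z.1.1, z.1.2, z.2) : ReducedConfig)) ''
        (signedPiece (d.1, d.2.1) ×ˢ {t : ℝ | 0 < ((d.2.2 : ℤ) : ℝ) * t}) := by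
    ext x
    constructor
    · exact fun hx => ⟨((x.1, x.2.1), x.2.2), ⟨⟨hx.1, hx.2.1⟩, hx.2.2⟩, rfl⟩
    · rintro ⟨z, ⟨h1, h2⟩, rfl⟩
      exact ⟨h1.1, h1.2, h2⟩
  rw [h]
  exact ((isPathConnected_signedPiece _).prod (isPathConnected_setOf_sign_mul_pos _)).image
    (by fun_prop)

theorem connectedComponentIn_nonsingularReduced {d : ℤˣ × ℤˣ × ℤˣ} {x : ReducedConfig}
    (hx : x ∈ reducedPiece d) : connectedComponentIn nonsingularReduced x = reducedPiece d :=
  connectedComponentIn_eq_of_partition nonsingularReduced_eq_iUnion isOpen_reducedPiece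
    disjoint_reducedPiece (fun d => (isPathConnected_reducedPiece d).isConnected.isPreconnected) hx

theorem card_components_nonsingularReduced :
    Nat.card (ConnectedComponents ↥nonsingularReduced) = 8 := by
  rw [card_connectedComponents_of_partition nonsingularReduced_eq_iUnion isOpen_reducedPiece
    disjoint_reducedPiece fun d => (isPathConnected_reducedPiece d).isConnected]
  simp [Nat.card_eq_fintype_card]

theorem exists_mem_reducedPiece {x : ReducedConfig} (hx : x ∈ nonsingularReduced) :
    ∃ d, x ∈ reducedPiece d := by
  rwa [nonsingularReduced_eq_iUnion, Set.mem_iUnion] at hx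

theorem mem_connectedComponentIn_nonsingularReduced_iff {x : ReducedConfig}
    (hx : x ∈ nonsingularReduced) (y : ReducedConfig) :
    y ∈ connectedComponentIn nonsingularReduced x ↔
      0 < BP x.1 x.2.1 * BP y.1 y.2.1 ∧ 0 < x.2.1.1 * y.2.1.1 ∧ 0 < x.2.2 * y.2.2 := by
  obtain ⟨d, hd⟩ := exists_mem_reducedPiece hx
  rw [connectedComponentIn_nonsingularReduced hd, ← sign_mul_pos_iff hd.1,
    ← sign_mul_pos_iff hd.2.1, ← sign_mul_pos_iff hd.2.2]
  rfl

/-! ### The components of the non-singular configurations -/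

/-- The component of the non-singular configurations given by the signs of the factors of the
determinant of the Jacobian. -/
def configPiece (d : ℤˣ × ℤˣ × ℤˣ) : Set (Fin 6 → Real.Angle) :=
  {θ | 0 < ((d.1 : ℤ) : ℝ) * bigFactor (θ 1) (θ 2) (θ 3) ∧
    0 < ((d.2.1 : ℤ) : ℝ) * (θ 2).sin ∧ 0 < ((d.2.2 : ℤ) : ℝ) * (θ 4).sin}

theorem compl_singularSet_eq_iUnion : (singularSet ur5)ᶜ = ⋃ d, configPiece d := by
  ext θ
  rw [Set.mem_compl_iff, mem_singularSet_iff_factors, not_or, not_or, Set.mem_iUnion, ← ne_eq,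
    ← ne_eq, ← ne_eq, ← exists_sign_mul_pos_iff, ← exists_sign_mul_pos_iff,
    ← exists_sign_mul_pos_iff]
  constructor
  · rintro ⟨⟨ε, hε⟩, ⟨η, hη⟩, ⟨κ, hκ⟩⟩
    exact ⟨(ε, η, κ), hε, hη, hκ⟩
  · rintro ⟨d, h1, h2, h3⟩
    exact ⟨⟨_, h1⟩, ⟨_, h2⟩, ⟨_, h3⟩⟩

theorem continuous_bigFactor {X : Type*} [TopologicalSpace X] {f g h : X → Real.Angle}
    (hf : Continuous f) (hg : Continuous g) (hh : Continuous h) :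
    Continuous fun x => bigFactor (f x) (g x) (h x) := by
  unfold bigFactor
  exact ((continuous_const.mul (Real.Angle.continuous_cos.comp hf)).add
    (continuous_const.mul (Real.Angle.continuous_cos.comp (hf.add hg)))).sub
    (continuous_const.mul (Real.Angle.continuous_sin.comp ((hf.add hg).add hh)))

theorem isOpen_configPiece (d : ℤˣ × ℤˣ × ℤˣ) : IsOpen (configPiece d) :=
  (isOpen_lt continuous_const ((continuous_sign_mul d.1).comp
    (continuous_bigFactor (continuous_apply 1) (continuous_apply 2) (continuous_apply 3)))).inter
    ((isOpen_lt continuous_const ((continuous_sign_mul d.2.1).comp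
      (Real.Angle.continuous_sin.comp (continuous_apply 2)))).inter
    (isOpen_lt continuous_const ((continuous_sign_mul d.2.2).comp
      (Real.Angle.continuous_sin.comp (continuous_apply 4)))))

theorem disjoint_configPiece (d e : ℤˣ × ℤˣ × ℤˣ) (h : d ≠ e) :
    Disjoint (configPiece d) (configPiece e) :=
  Set.disjoint_left.2 fun _ h₁ h₂ => h <| Prod.ext (sign_eq_of_mul_pos h₁.1 h₂.1)
    (Prod.ext (sign_eq_of_mul_pos h₁.2.1 h₂.2.1) (sign_eq_of_mul_pos h₁.2.2 h₂.2.2))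

/-- The half-angle substitution changes each of the three factors only by a positive multiple, so it
preserves the signs. -/
theorem jointAngles_mem_configPiece_iff (d : ℤˣ × ℤˣ × ℤˣ) (θ₁ θ₆ : Real.Angle)
    (x : ReducedConfig) : jointAngles θ₁ θ₆ x ∈ configPiece d ↔ x ∈ reducedPiece d := by
  have hp : 0 < (1 + x.2.1.1 ^ 2) * (1 + x.2.1.2 ^ 2) := by positivity
  have h1 : BP x.1 x.2.1 = (1 + x.2.1.1 ^ 2) * (1 + x.2.1.2 ^ 2) * bigFactor x.1
      ((2 * Real.arctan x.2.1.1 : ℝ) : Real.Angle) ((2 * Real.arctan x.2.1.2 : ℝ) : Real.Angle) :=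
    BP_eq_mul_bigFactor x.1 x.2.1.1 x.2.1.2
  simp only [configPiece, reducedPiece, Set.mem_ofPred_eq]
  rw [h1, mul_left_comm, mul_pos_iff_of_pos_left hp, ← sin_two_arctan_mul_pos_iff _ x.2.1.1,
    ← sin_two_arctan_mul_pos_iff _ x.2.2]
  rfl

theorem jointAngles_mem_singularSet_iff (θ₁ θ₆ : Real.Angle) (x : ReducedConfig) :
    jointAngles θ₁ θ₆ x ∈ singularSet ur5 ↔ AP x = 0 := by
  rw [← not_iff_not, ← Set.mem_compl_iff, compl_singularSet_eq_iUnion, Set.mem_iUnion]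
  simp only [jointAngles_mem_configPiece_iff]
  rw [← Set.mem_iUnion, ← nonsingularReduced_eq_iUnion]
  rfl

theorem continuous_jointAngles :
    Continuous fun z : (Real.Angle × Real.Angle) × ReducedConfig =>
      jointAngles z.1.1 z.1.2 z.2 := by
  have h (f : (Real.Angle × Real.Angle) × ReducedConfig → ℝ) (hf : Continuous f) :
      Continuous fun z => ((2 * Real.arctan (f z) : ℝ) : Real.Angle) :=
    Real.Angle.continuous_coe.comp (continuous_const.mul (Real.continuous_arctan.comp hf))
  refine continuous_pi fun i => ?_
  fin_cases i
  · exact continuous_fst.comp continuous_fst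
  · exact continuous_fst.comp continuous_snd
  · exact h _ (by fun_prop)
  · exact h _ (by fun_prop)
  · exact h _ (by fun_prop)
  · exact continuous_snd.comp continuous_fst

theorem isPathConnected_image_jointAngles (d : ℤˣ × ℤˣ × ℤˣ) :
    IsPathConnected ((fun z : (Real.Angle × Real.Angle) × ReducedConfig =>
      jointAngles z.1.1 z.1.2 z.2) '' ((Set.univ ×ˢ Set.univ) ×ˢ reducedPiece d)) :=
  ((isPathConnected_univ_angle.prod isPathConnected_univ_angle).prod
    (isPathConnected_reducedPiece d)).image continuous_jointAngles

/-- From a non-singular configuration one can leave `θ₄ = π` by moving `θ₄` alone. -/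
theorem exists_joinedIn_ne_pi {d : ℤˣ × ℤˣ × ℤˣ} {θ : Fin 6 → Real.Angle}
    (hθ : θ ∈ configPiece d) : ∃ φ : Fin 6 → Real.Angle, φ 3 ≠ (Real.pi : Real.Angle) ∧
      JoinedIn {ψ | ψ ∈ configPiece d ∧ ∀ i, i ≠ 3 → ψ i = θ i} θ φ := by
  by_cases h3 : θ 3 = (Real.pi : Real.Angle)
  · set g : ℝ → (Fin 6 → Real.Angle) :=
      fun t => Function.update θ 3 (θ 3 + (t : Real.Angle)) with hg
    have hgc : Continuous g :=
      continuous_const.update 3 (continuous_const.add Real.Angle.continuous_coe)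
    have hg0 : g 0 = θ := by simp [hg]
    have hmem : g ⁻¹' configPiece d ∈ nhds (0 : ℝ) :=
      ((isOpen_configPiece d).preimage hgc).mem_nhds (by rwa [Set.mem_preimage, hg0])
    obtain ⟨r, hr, hball⟩ := Metric.mem_nhds_iff.1 hmem
    -- The bound by `r` keeps the move inside the open piece; the bound by `1 < π` gives `sin s >
    -- 0`, so the angle has really left `π`.
    set s := min (r / 2) 1 with hs
    have hs0 : 0 < s := lt_min (by linarith) one_pos
    have hsr : s < r := (min_le_left _ _).trans_lt (by linarith)
    have hs1 : s ≤ 1 := min_le_right _ _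
    refine ⟨g s, ?_, ?_⟩
    · intro h
      simp only [hg, Function.update_self, h3, add_eq_left] at h
      have h1 := congrArg Real.Angle.sin h
      rw [Real.Angle.sin_coe, Real.Angle.sin_zero] at h1
      exact (Real.sin_pos_of_pos_of_lt_pi hs0 (by linarith [Real.pi_gt_three])).ne' h1
    · have h1 : IsPathConnected (g '' Metric.ball 0 r) :=
        ((convex_ball (0 : ℝ) r).isPathConnected ⟨0, Metric.mem_ball_self hr⟩).image hgc
      refine (h1.joinedIn θ ⟨0, Metric.mem_ball_self hr, hg0⟩ (g s) ⟨s, ?_, rfl⟩).mono ?_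
      · rw [Metric.mem_ball, dist_zero_right, Real.norm_eq_abs, abs_of_pos hs0]
        exact hsr
      · rintro _ ⟨t, ht, rfl⟩
        exact ⟨hball ht, fun i hi => Function.update_of_ne hi _ _⟩
  · exact ⟨θ, h3, JoinedIn.refl ⟨hθ, fun _ _ => rfl⟩⟩

theorem sin_mul_pos_ne_pi {ε : ℝ} {θ : Real.Angle} (h : 0 < ε * θ.sin) :
    θ ≠ (Real.pi : Real.Angle) := by
  rintro rfl
  simp at h

/-- In a piece the sines of `θ₃` and `θ₅` are non-zero, so these angles are in the chart
automatically; only `θ₄` needs a hypothesis. -/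
theorem exists_jointAngles_eq {d : ℤˣ × ℤˣ × ℤˣ} {θ : Fin 6 → Real.Angle} (hθ : θ ∈ configPiece d)
    (h3 : θ 3 ≠ (Real.pi : Real.Angle)) :
    ∃ x ∈ reducedPiece d, jointAngles (θ 0) (θ 5) x = θ := by
  obtain ⟨a, ha⟩ := exists_eq_two_arctan (sin_mul_pos_ne_pi hθ.2.1)
  obtain ⟨b, hb⟩ := exists_eq_two_arctan h3
  obtain ⟨c, hc⟩ := exists_eq_two_arctan (sin_mul_pos_ne_pi hθ.2.2)
  have h : jointAngles (θ 0) (θ 5) (θ 1, (a, b), c) = θ := by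
    ext i
    fin_cases i
    exacts [rfl, rfl, ha.symm, hb.symm, hc.symm, rfl]
  exact ⟨(θ 1, (a, b), c), (jointAngles_mem_configPiece_iff d (θ 0) (θ 5) _).1 (h.symm ▸ hθ), h⟩

/-- The image of the chart is path connected, and every point of the piece reaches it by moving `θ₄`
alone. -/
theorem isPathConnected_configPiece (d : ℤˣ × ℤˣ × ℤˣ) : IsPathConnected (configPiece d) := by
  have h := isPathConnected_image_jointAngles d
  obtain ⟨p, hp, hp'⟩ := h
  have hsub : (fun z : (Real.Angle × Real.Angle) × ReducedConfig =>
      jointAngles z.1.1 z.1.2 z.2) '' ((Set.univ ×ˢ Set.univ) ×ˢ reducedPiece d) ⊆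
        configPiece d := by
    rintro _ ⟨z, hz, rfl⟩
    exact (jointAngles_mem_configPiece_iff _ _ _ _).2 hz.2
  refine ⟨p, hsub hp, fun {θ} hθ => ?_⟩
  obtain ⟨φ, hφ, hj⟩ := exists_joinedIn_ne_pi hθ
  obtain ⟨x, hx, hxφ⟩ := exists_jointAngles_eq hj.target_mem.1 hφ
  exact ((hp' ⟨((φ 0, φ 5), x), ⟨⟨trivial, trivial⟩, hx⟩, hxφ⟩).mono hsub).trans
    (hj.mono fun _ h => h.1).symm

theorem connectedComponentIn_compl_singularSet {d : ℤˣ × ℤˣ × ℤˣ} {θ : Fin 6 → Real.Angle}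
    (hθ : θ ∈ configPiece d) :
    connectedComponentIn (singularSet ur5)ᶜ θ = configPiece d :=
  connectedComponentIn_eq_of_partition compl_singularSet_eq_iUnion isOpen_configPiece
    disjoint_configPiece (fun d => (isPathConnected_configPiece d).isConnected.isPreconnected) hθ

theorem card_components_compl_singularSet :
    Nat.card (ConnectedComponents ↥(singularSet ur5)ᶜ) = 8 := by
  rw [card_connectedComponents_of_partition compl_singularSet_eq_iUnion isOpen_configPiece
    disjoint_configPiece fun d => (isPathConnected_configPiece d).isConnected]
  simp [Nat.card_eq_fintype_card]

theorem configPiece_subset (d : ℤˣ × ℤˣ × ℤˣ) : configPiece d ⊆ (singularSet ur5)ᶜ :=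
  compl_singularSet_eq_iUnion ▸ Set.subset_iUnion _ d

theorem exists_mem_configPiece {θ : Fin 6 → Real.Angle} (hθ : θ ∈ (singularSet ur5)ᶜ) :
    ∃ d, θ ∈ configPiece d := by
  rwa [compl_singularSet_eq_iUnion, Set.mem_iUnion] at hθ

/-! ### The connecting paths -/

/-- The fiber points where `B̃` has sign `ε` form the open half circle centred at the midpoint, so
the arc to the centre stays in it. -/
theorem joinedIn_midpoint {ε : ℤˣ} {x : ReducedConfig} (hx : x ∈ nonsingularReduced)
    (hε : 0 < ((ε : ℤ) : ℝ) * BP x.1 x.2.1) :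
    JoinedIn {z | z ∈ nonsingularReduced ∧ z.2 = x.2} x (midpoint ε x.2.1, x.2) := by
  obtain ⟨h0, hc⟩ := (sign_mul_BP_pos_iff _ _ _).1 hε
  have hp : IsPathConnected ((fun φ : Real.Angle => ((midpoint ε x.2.1 + φ, x.2) : ReducedConfig)) ''
      {φ : Real.Angle | 0 < φ.cos}) :=
    isPathConnected_setOf_cos_pos.image
      ((continuous_const.add continuous_id).prodMk continuous_const)
  refine (hp.joinedIn x ⟨x.1 - midpoint ε x.2.1, hc, by simp⟩ _ ⟨0, by simp, by simp⟩).mono ?_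
  rintro _ ⟨φ, hφ, rfl⟩
  rw [mem_nonsingularReduced_iff] at hx
  refine ⟨(mem_nonsingularReduced_iff _).2 ⟨(exists_sign_mul_pos_iff _).1 ⟨ε, ?_⟩, hx.2⟩, rfl⟩
  exact (sign_mul_BP_pos_iff _ _ _).2 ⟨h0, by simpa using hφ⟩

theorem sign_mul_BP_midpoint_pos (ε : ℤˣ) {q : ℝ × ℝ} (h : gradient q ≠ 0) :
    0 < ((ε : ℤ) : ℝ) * BP (midpoint ε q) q :=
  (sign_mul_BP_pos_iff _ _ _).2 ⟨h, by simp⟩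

theorem lineMap_ne_zero {a b : ℝ} (h : 0 < a * b) (t : unitInterval) :
    AffineMap.lineMap a b (t : ℝ) ≠ 0 := by
  intro h0
  rw [AffineMap.lineMap_apply, vsub_eq_sub, vadd_eq_add, smul_eq_mul] at h0
  have ha : 0 < a * a := mul_self_pos.2 fun h1 => by simp [h1] at h
  -- Multiplied by `a`, the interpolation is a sum of two non-negative terms, which cannot vanish
  -- together.
  have h1 : (1 - (t : ℝ)) * (a * a) + t * (a * b) = 0 := by linear_combination a * h0
  have h2 := mul_nonneg t.2.1 h.le
  have h3 := mul_nonneg (sub_nonneg.2 t.2.2) ha.le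
  have h4 : (t : ℝ) * (a * b) = 0 := by linarith
  have h5 : (t : ℝ) = 0 := (mul_eq_zero.1 h4).resolve_right h.ne'
  rw [h5] at h1
  linarith

/-- At the midpoint, `ε` times `B̃` equals the norm of the gradient, which is positive on all of
`Y`. So along the midpoints any path in `Y` is admissible, and the only obstacles for segments are
the poles. -/
theorem connecting_paths {ε : ℤˣ} {x y : ReducedConfig} (hx : x ∈ nonsingularReduced)
    (hy : y ∈ connectedComponentIn nonsingularReduced x)
    (hε : 0 < ((ε : ℤ) : ℝ) * BP x.1 x.2.1) :
    x.2.1 ∈ baseY (pole (-1)) (pole 1) ∧ y.2.1 ∈ baseY (pole (-1)) (pole 1) ∧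
      JoinedIn {z | z ∈ nonsingularReduced ∧ z.2 = x.2} x (midpoint ε x.2.1, x.2) ∧
      JoinedIn {z | z ∈ nonsingularReduced ∧ z.2 = y.2} (midpoint ε y.2.1, y.2) y ∧
      (pole (-1) ∉ segment ℝ x.2.1 y.2.1 → pole 1 ∉ segment ℝ x.2.1 y.2.1 →
        segment ℝ x.2.1 y.2.1 ⊆ baseY (pole (-1)) (pole 1)) ∧
      (∃ r, segment ℝ x.2.1 r ⊆ baseY (pole (-1)) (pole 1) ∧
        segment ℝ r y.2.1 ⊆ baseY (pole (-1)) (pole 1)) ∧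
      ∀ γ : Path x.2.1 y.2.1, (∀ t, γ t ∈ baseY (pole (-1)) (pole 1)) →
        Continuous (fun t => midpoint ε (γ t)) ∧
        ∀ t : unitInterval,
          ((midpoint ε (γ t), γ t, AffineMap.lineMap x.2.2 y.2.2 (t : ℝ)) : ReducedConfig) ∈
            nonsingularReduced := by
  obtain ⟨d, hd⟩ := exists_mem_reducedPiece hx
  obtain rfl := sign_eq_of_mul_pos hε hd.1
  have hsigns := (mem_connectedComponentIn_nonsingularReduced_iff hx y).1 hy
  have hyN := connectedComponentIn_subset _ _ hy
  rw [connectedComponentIn_nonsingularReduced hd] at hy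
  have hxY : x.2.1 ∈ halfY d.2.1 := snd_mem_halfY (d := (d.1, d.2.1)) (x := (x.1, x.2.1))
    ⟨hd.1, hd.2.1⟩
  have hyY : y.2.1 ∈ halfY d.2.1 := snd_mem_halfY (d := (d.1, d.2.1)) (x := (y.1, y.2.1))
    ⟨hy.1, hy.2.1⟩
  have hsub : halfY d.2.1 ⊆ baseY (pole (-1)) (pole 1) := fun _ h => mem_baseY_of_mem_halfY h
  refine ⟨hsub hxY, hsub hyY, joinedIn_midpoint hx hε, (joinedIn_midpoint hyN hy.1).symm,
    fun h1 h2 => ?_, ?_, fun γ hγ => ⟨?_, fun t => ?_⟩⟩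
  -- Both endpoints lie in the same half-plane, so only its own pole can be in the way.
  · refine (segment_subset_halfY hxY.1 hyY.1 ?_).trans hsub
    rcases Int.units_eq_one_or d.2.1 with h | h <;> rwa [h]
  · obtain ⟨r, h1, h2⟩ := exists_segments_subset_halfY hxY hyY
    exact ⟨r, h1.trans hsub, h2.trans hsub⟩
  · exact continuous_iff_continuousAt.2 fun t =>
      (continuousAt_midpoint d.1 (gradient_ne_zero (hγ t))).comp (f := γ) γ.continuous.continuousAt
  · rw [mem_nonsingularReduced_iff]
    exact ⟨(exists_sign_mul_pos_iff _).1 ⟨d.1, sign_mul_BP_midpoint_pos _ (gradient_ne_zero (hγ t))⟩,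
      fun h => hγ t (Or.inr h), lineMap_ne_zero hsigns.2.2 t⟩

end UR5

end

/-! ### The main theorem, with the two poles as `q₁` and `q₂` -/

theorem mainTheorem2 :
    -- The singular set in the half-angle parameters
    (∀ θ : Fin 6 → Real.Angle, θ 2 = (Real.pi : Real.Angle) ∨ θ 4 = (Real.pi : Real.Angle) →
      θ ∈ UR5.singularSet UR5.ur5) ∧
    (∀ (θ₁ θ₆ : Real.Angle) (x : UR5.ReducedConfig),
      UR5.jointAngles θ₁ θ₆ x ∈ UR5.singularSet UR5.ur5 ↔ UR5.AP x = 0) ∧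
    -- The numbers of components, in the configuration space and in the half-angle parameters
    Nat.card (ConnectedComponents ↥(UR5.singularSet UR5.ur5)ᶜ) = 8 ∧
    Nat.card (ConnectedComponents ↥UR5.nonsingularReduced) = 8 ∧
    (∀ (θ₁ θ₆ φ₁ φ₆ : Real.Angle), ∀ x ∈ UR5.nonsingularReduced, ∀ y ∈ UR5.nonsingularReduced,
      (UR5.jointAngles φ₁ φ₆ y ∈
          connectedComponentIn (UR5.singularSet UR5.ur5)ᶜ (UR5.jointAngles θ₁ θ₆ x) ↔
        y ∈ connectedComponentIn UR5.nonsingularReduced x)) ∧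
    -- The discriminant with respect to `v₂`
    Polynomial.discr UR5.Btilde =
      MvPolynomial.C (1 / 50000000) * (1 + MvPolynomial.X 0 ^ 2) * (1 + MvPolynomial.X 1 ^ 2) *
        (UR5.cPoly ^ 2 + UR5.dPoly ^ 2) ∧
    (∃ e f : MvPolynomial (Fin 2) ℝ, Polynomial.discr UR5.Btilde = e ^ 2 + f ^ 2) ∧
    ∃ q₁ q₂ : ℝ × ℝ,
      (|q₁.1 + 9.140975564| < 1 / 10 ^ 8 ∧ |q₁.2 + 8.218388067| < 1 / 10 ^ 8 ∧
        |q₂.1 - 9.140975563| < 1 / 10 ^ 8 ∧ |q₂.2 + 0.1216783622| < 1 / 10 ^ 8) ∧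
      {q : ℝ × ℝ | MvPolynomial.eval ![q.1, q.2] (Polynomial.discr UR5.Btilde) = 0} = {q₁, q₂} ∧
      (∀ k : ℕ, UR5.Bcoeff k q₁ = 0 ∧ UR5.Bcoeff k q₂ = 0) ∧
      -- The two sheets and the complement of the zero set over `Y`
      IsCoveringMapOn (fun x : ↥UR5.zeroSetB => (x : Real.Angle × (ℝ × ℝ)).2)
        (UR5.baseY q₁ q₂) ∧
      (∃ s₁ s₂ : ℝ × ℝ → Real.Angle,
        ContinuousOn s₁ (UR5.baseY q₁ q₂) ∧ ContinuousOn s₂ (UR5.baseY q₁ q₂) ∧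
        ∀ q ∈ UR5.baseY q₁ q₂, s₁ q ≠ s₂ q ∧ {θ | UR5.BP θ q = 0} = {s₁ q, s₂ q}) ∧
      IsConnected UR5.zeroSetB ∧
      (∀ q ∈ UR5.baseY q₁ q₂,
        IsConnected {θ | 0 < UR5.BP θ q} ∧ IsConnected {θ | UR5.BP θ q < 0}) ∧
      Nat.card (ConnectedComponents ↥(UR5.baseY q₁ q₂)) = 2 ∧
      Nat.card (ConnectedComponents
        ↥{x : Real.Angle × (ℝ × ℝ) | x ∉ UR5.zeroSetB ∧ x.2 ∈ UR5.baseY q₁ q₂}) = 4 ∧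
      (∀ x ∈ UR5.nonsingularReduced, ∀ y ∈ UR5.nonsingularReduced,
        (y ∈ connectedComponentIn UR5.nonsingularReduced x ↔
          0 < UR5.BP x.1 x.2.1 * UR5.BP y.1 y.2.1 ∧ 0 < x.2.1.1 * y.2.1.1 ∧
            0 < x.2.2 * y.2.2)) ∧
      -- The connecting paths: along a fiber, along a path of midpoints, along a fiber
      (∃ m : ℤˣ → ℝ × ℝ → Real.Angle,
        (∀ ε, ContinuousOn (m ε) (UR5.baseY q₁ q₂)) ∧
        (∀ ε : ℤˣ, ∀ q ∈ UR5.baseY q₁ q₂, 0 < ((ε : ℤ) : ℝ) * UR5.BP (m ε q) q) ∧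
        (∀ q ∈ UR5.baseY q₁ q₂, ∀ θ, UR5.IsMidpoint q θ ↔ ∃ ε, θ = m ε q) ∧
        ∀ x ∈ UR5.nonsingularReduced, ∀ y ∈ connectedComponentIn UR5.nonsingularReduced x,
        ∀ ε : ℤˣ, 0 < ((ε : ℤ) : ℝ) * UR5.BP x.1 x.2.1 →
          x.2.1 ∈ UR5.baseY q₁ q₂ ∧ y.2.1 ∈ UR5.baseY q₁ q₂ ∧
          JoinedIn {z | z ∈ UR5.nonsingularReduced ∧ z.2 = x.2} x (m ε x.2.1, x.2) ∧
          JoinedIn {z | z ∈ UR5.nonsingularReduced ∧ z.2 = y.2} (m ε y.2.1, y.2) y ∧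
          (q₁ ∉ segment ℝ x.2.1 y.2.1 → q₂ ∉ segment ℝ x.2.1 y.2.1 →
            segment ℝ x.2.1 y.2.1 ⊆ UR5.baseY q₁ q₂) ∧
          (∃ r, segment ℝ x.2.1 r ⊆ UR5.baseY q₁ q₂ ∧ segment ℝ r y.2.1 ⊆ UR5.baseY q₁ q₂) ∧
          ∀ γ : Path x.2.1 y.2.1, (∀ t, γ t ∈ UR5.baseY q₁ q₂) →
            Continuous (fun t => m ε (γ t)) ∧
            ∀ t : unitInterval,
              ((m ε (γ t), γ t, AffineMap.lineMap x.2.2 y.2.2 (t : ℝ)) : UR5.ReducedConfig) ∈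
                UR5.nonsingularReduced) ∧
      -- The same in the configuration space
      (∀ θ ∈ (UR5.singularSet UR5.ur5)ᶜ,
        ∃ φ : Fin 6 → Real.Angle, φ 3 ≠ (Real.pi : Real.Angle) ∧
          JoinedIn {ψ | ψ ∈ (UR5.singularSet UR5.ur5)ᶜ ∧ ∀ i, i ≠ 3 → ψ i = θ i} θ φ) ∧
      ∀ θ ∈ (UR5.singularSet UR5.ur5)ᶜ,
        ∀ φ ∈ connectedComponentIn (UR5.singularSet UR5.ur5)ᶜ θ,
          JoinedIn (UR5.singularSet UR5.ur5)ᶜ θ φ := by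
  have hs {q : ℝ × ℝ} (h : q ∈ UR5.baseY (UR5.pole (-1)) (UR5.pole 1)) :=
    UR5.gradient_ne_zero h
  refine ⟨fun θ hθ => ?_, UR5.jointAngles_mem_singularSet_iff,
    UR5.card_components_compl_singularSet, UR5.card_components_nonsingularReduced,
    fun θ₁ θ₆ φ₁ φ₆ x hx y hy => ?_, UR5.discr_Btilde, UR5.discr_Btilde_eq_sq_add_sq,
    UR5.pole (-1), UR5.pole 1, UR5.pole_bounds, ?_,
    fun k => ⟨UR5.Bcoeff_pole _ k, UR5.Bcoeff_pole _ k⟩, UR5.isCoveringMapOn_zeroSetB,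
    ⟨UR5.sheet 1, UR5.sheet (-1),
      fun q hq => (UR5.continuousAt_sheet 1 (hs hq)).continuousWithinAt,
      fun q hq => (UR5.continuousAt_sheet (-1) (hs hq)).continuousWithinAt,
      fun q hq => ⟨UR5.sheet_ne q, Set.ext (UR5.BP_eq_zero_iff (hs hq))⟩⟩,
    UR5.isConnected_zeroSetB, fun q hq => ⟨?_, ?_⟩, UR5.card_components_baseY,
    UR5.card_components_compl_zeroSetB,
    fun x hx y _ => UR5.mem_connectedComponentIn_nonsingularReduced_iff hx y,
    ⟨UR5.midpoint, fun ε q hq => (UR5.continuousAt_midpoint ε (hs hq)).continuousWithinAt,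
      fun ε q hq => UR5.sign_mul_BP_midpoint_pos ε (hs hq),
      fun q hq => UR5.isMidpoint_iff (hs hq),
      fun x hx y hy ε hε => UR5.connecting_paths hx hy hε⟩,
    fun θ hθ => ?_, fun θ hθ φ hφ => ?_⟩
  · rw [UR5.mem_singularSet_iff_factors, Real.Angle.sin_eq_zero_iff, Real.Angle.sin_eq_zero_iff]
    tauto
  · obtain ⟨d, hd⟩ := UR5.exists_mem_reducedPiece hx
    rw [UR5.connectedComponentIn_nonsingularReduced hd, UR5.connectedComponentIn_compl_singularSet
      ((UR5.jointAngles_mem_configPiece_iff d θ₁ θ₆ x).2 hd), UR5.jointAngles_mem_configPiece_iff]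
  · ext q
    rw [Set.mem_ofPred_eq, UR5.eval_discr, UR5.coeffs_eq_zero_iff]
    rfl
  · simpa using UR5.isConnected_setOf_sign_mul_BP_pos 1 (hs hq)
  · simpa using UR5.isConnected_setOf_sign_mul_BP_pos (-1) (hs hq)
  · obtain ⟨d, hd⟩ := UR5.exists_mem_configPiece hθ
    obtain ⟨φ, hφ, hj⟩ := UR5.exists_joinedIn_ne_pi hd
    exact ⟨φ, hφ, hj.mono fun ψ hψ => ⟨UR5.configPiece_subset d hψ.1, hψ.2⟩⟩
  · obtain ⟨d, hd⟩ := UR5.exists_mem_configPiece hθ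
    rw [UR5.connectedComponentIn_compl_singularSet hd] at hφ
    exact ((UR5.isPathConnected_configPiece d).joinedIn θ hd φ hφ).mono (UR5.configPiece_subset d)
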